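/- Let $d\ge 1$ and let $X_d$ be the real unital associative algebra with generators $e_1,\dots,e_{d+2}$ and relations $e_j^2=-\boldsymbol 1$ and $e_je_k=-e_ke_j$ for distinct $j,k\le d+1$, $e_{d+2}^2=0$, and $e_{d+2}e_j=e_je_{d+2}$ for $j\le d+1$. Let $i:\mathbb R^d\to X_d$ be the linear map sending the standard basis to $e_1,\dots,e_d$. Let $\alpha$ be the automorphism of $X_d$ with $\alpha(e_j)=-e_j$ for $j\le d+1$ and $\alpha(e_{d+2})=e_{d+2}$, let $t$ be the anti-automorphism of $X_d$ fixing every $e_j$, and put $\overline x=\alpha(t(x))$ and $N(x)=x\overline x$. For even $m\geq 0$, an $m$-term is the product, in increasing order of indices, of $m$ distinct elements of the list $e_1,\dots,e_d,\,e_{d+1}e_{d+2}$ (where $e_{d+1}e_{d+2}$ counts as one element, placed last; the only $0$-term is $\boldsymbol 1$). Let $Z_d^0\subset X_d$ be the subspace with basis all the $m$-terms with $m$ even, and identify it with $\mathbb R^{2^d}$ through this basis, the first coordinate $x_1$ being the coefficient of $\boldsymbol 1$. Let $H_0\subset Z_d^0$ be the hyperplane $x_1=0$. Let $\mathrm{Spun}(d)$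 be the set of all $z\in Z_d^0$ with $N(z)=\boldsymbol 1$ such that for every $v\in\mathbb R^d$ there is a $w\in\mathbb R^d$ with $$z\,(e_{d+2}i(v)+e_{d+1})\,\overline z=e_{d+2}i(w)+e_{d+1}.$$ For $a,p\in\mathbb R^d$ let $$T_{ap}=\{x\in \mathrm{Spun}(d):\ x\,(e_{d+2}i(a)+e_{d+1})\,\overline x=e_{d+2}i(p)+e_{d+1}\}.$$ Let $\eta_d:Z_d^0\setminus H_0\to\mathbb R^{\binom{d+1}{2}}$ be the map that sends $x$ to the vector of the coefficients of the $2$-terms in $x/x_1$, and let $L_{ap}=\eta_d(T_{ap}\setminus H_0)$. A $k$-flat is a nonempty affine subspace of dimension $k$. **Lemma 5.13.** Let $a,p,b,q\in\mathbb R^d$. Suppose that $T_{ap}\ne T_{bq}$ and that $T_{ap}\cap T_{bq}\not\subseteq H_0$. Then $L_{ap}$ and $L_{bq}$ are $\binom d2$-flats in $\mathbb R^{\binom{d+1}2}$, and $L_{ap}\cap L_{bq}$ is a flat of dimension $\binom{d-1}2$. -/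

import Mathlib

namespace SpunGroup

/-- Defining relations of the algebra `X_d` on generators `e_1, …, e_{d+2}` (the index `j : Fin (d+2)`
stands for `e_{j+1}`): `e_1, …, e_{d+1}` are pairwise anticommuting square roots of `-1`, while
`e_{d+2}` squares to `0` and commutes with all the others. -/
inductive Rel (d : ℕ) : FreeAlgebra ℝ (Fin (d + 2)) → FreeAlgebra ℝ (Fin (d + 2)) → Prop
  | anticomm (j k : Fin (d + 1)) (h : j ≠ k) :
      Rel d (FreeAlgebra.ι ℝ j.castSucc * FreeAlgebra.ι ℝ k.castSucc
        + FreeAlgebra.ι ℝ k.castSucc * FreeAlgebra.ι ℝ j.castSucc) 0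
  | sq (j : Fin (d + 1)) :
      Rel d (FreeAlgebra.ι ℝ j.castSucc * FreeAlgebra.ι ℝ j.castSucc + 1) 0
  | lastSq :
      Rel d (FreeAlgebra.ι ℝ (Fin.last (d + 1)) * FreeAlgebra.ι ℝ (Fin.last (d + 1))) 0
  | lastComm (j : Fin (d + 1)) :
      Rel d (FreeAlgebra.ι ℝ (Fin.last (d + 1)) * FreeAlgebra.ι ℝ j.castSucc
        - FreeAlgebra.ι ℝ j.castSucc * FreeAlgebra.ι ℝ (Fin.last (d + 1))) 0

/-- The real algebra `X_d`: the quotient of the free (i.e. tensor) algebra on `e_1, …, e_{d+2}` by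
the two-sided ideal generated by the relations above. -/
def X (d : ℕ) : Type := RingQuot (Rel d)

noncomputable instance (d : ℕ) : Ring (X d) := inferInstanceAs (Ring (RingQuot (Rel d)))

noncomputable instance (d : ℕ) : Algebra ℝ (X d) :=
  inferInstanceAs (Algebra ℝ (RingQuot (Rel d)))

/-- The quotient map. -/
noncomputable def mk (d : ℕ) : FreeAlgebra ℝ (Fin (d + 2)) →ₐ[ℝ] X d :=
  RingQuot.mkAlgHom ℝ (Rel d)

theorem mk_rel {d : ℕ} {x y : FreeAlgebra ℝ (Fin (d + 2))} (h : Rel d x y) : mk d x = mk d y :=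
  RingQuot.mkAlgHom_rel ℝ h

/-- The generators; `e d j` is `e_{j+1}`. -/
noncomputable def e (d : ℕ) (j : Fin (d + 2)) : X d := mk d (FreeAlgebra.ι ℝ j)

/-- The generator `e_{d+1}`. -/
noncomputable def ePen (d : ℕ) : X d := e d (Fin.last d).castSucc

/-- The generator `e_{d+2}`. -/
noncomputable def eLast (d : ℕ) : X d := e d (Fin.last (d + 1))

/-- The universal property of `X_d`. -/
noncomputable def lift {d : ℕ} {A : Type*} [Ring A] [Algebra ℝ A] (g : Fin (d + 2) → A)
    (h1 : ∀ j k : Fin (d + 1), j ≠ k →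
      g j.castSucc * g k.castSucc + g k.castSucc * g j.castSucc = 0)
    (h2 : ∀ j : Fin (d + 1), g j.castSucc * g j.castSucc + 1 = 0)
    (h3 : g (Fin.last (d + 1)) * g (Fin.last (d + 1)) = 0)
    (h4 : ∀ j : Fin (d + 1), g (Fin.last (d + 1)) * g j.castSucc
      - g j.castSucc * g (Fin.last (d + 1)) = 0) : X d →ₐ[ℝ] A :=
  RingQuot.liftAlgHom ℝ ⟨FreeAlgebra.lift ℝ g, by
    intro x y hxy
    cases hxy with
    | anticomm j k h => simpa using h1 j k h
    | sq j => simpa using h2 j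
    | lastSq => simpa using h3
    | lastComm j => simpa using h4 j⟩

theorem lift_e {d : ℕ} {A : Type*} [Ring A] [Algebra ℝ A] (g : Fin (d + 2) → A)
    (h1 h2 h3 h4) (j : Fin (d + 2)) : lift g h1 h2 h3 h4 (e d j) = g j := by
  have h := RingQuot.liftAlgHom_mkAlgHom_apply ℝ (s := Rel d) (FreeAlgebra.lift ℝ g)
    (by
      intro x y hxy
      cases hxy with
      | anticomm j k h => simpa using h1 j k h
      | sq j => simpa using h2 j
      | lastSq => simpa using h3
      | lastComm j => simpa using h4 j) (FreeAlgebra.ι ℝ j)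
  exact h.trans (FreeAlgebra.lift_ι_apply g j)

theorem e_anticomm (d : ℕ) (j k : Fin (d + 1)) (h : j ≠ k) :
    e d j.castSucc * e d k.castSucc + e d k.castSucc * e d j.castSucc = 0 := by
  simpa [e] using mk_rel (Rel.anticomm j k h)

theorem e_sq (d : ℕ) (j : Fin (d + 1)) : e d j.castSucc * e d j.castSucc + 1 = 0 := by
  simpa [e] using mk_rel (Rel.sq j)

theorem e_lastSq (d : ℕ) : e d (Fin.last (d + 1)) * e d (Fin.last (d + 1)) = 0 := by
  simpa [e] using mk_rel (Rel.lastSq (d := d))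

theorem e_lastComm (d : ℕ) (j : Fin (d + 1)) :
    e d (Fin.last (d + 1)) * e d j.castSucc - e d j.castSucc * e d (Fin.last (d + 1)) = 0 := by
  simpa [e] using mk_rel (Rel.lastComm j)

/-- The linear map `i : ℝ^d → X_d` sending the standard basis to `e_1, …, e_d`. -/
noncomputable def i (d : ℕ) : EuclideanSpace ℝ (Fin d) →ₗ[ℝ] X d where
  toFun v := ∑ j : Fin d, v j • e d j.castSucc.castSucc
  map_add' v w := by simp [add_smul, Finset.sum_add_distrib]
  map_smul' c v := by simp [mul_smul, Finset.smul_sum]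

/-- The automorphism `α` of `X_d`: `e_j ↦ -e_j` for `j ≤ d+1`, and `e_{d+2} ↦ e_{d+2}`. -/
noncomputable def alpha (d : ℕ) : X d →ₐ[ℝ] X d :=
  lift (Fin.lastCases (e d (Fin.last (d + 1))) (fun j => -e d j.castSucc))
    (by intro j k h; simpa using e_anticomm d j k h)
    (by intro j; simpa using e_sq d j)
    (by simpa using e_lastSq d)
    (by
      intro j
      have := e_lastComm d j
      simp only [Fin.lastCases_last, Fin.lastCases_castSucc]
      rw [mul_neg, neg_mul, ← neg_eq_zero, ← this]
      abel)

/-- The anti-automorphism `t` of `X_d` fixing every `e_j`, as a homomorphism to the opposite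
algebra. -/
noncomputable def reversal (d : ℕ) : X d →ₐ[ℝ] (X d)ᵐᵒᵖ :=
  lift (fun j => MulOpposite.op (e d j))
    (by
      intro j k h
      rw [← MulOpposite.op_mul, ← MulOpposite.op_mul, ← MulOpposite.op_add,
        e_anticomm d k j h.symm, MulOpposite.op_zero])
    (by
      intro j
      rw [← MulOpposite.op_mul, ← MulOpposite.op_one, ← MulOpposite.op_add, e_sq,
        MulOpposite.op_zero])
    (by rw [← MulOpposite.op_mul, e_lastSq, MulOpposite.op_zero])
    (by
      intro j
      rw [← MulOpposite.op_mul, ← MulOpposite.op_mul, ← MulOpposite.op_sub, ← neg_sub,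
        e_lastComm, neg_zero, MulOpposite.op_zero])

/-- The conjugate `x̄ = α(t(x))`. -/
noncomputable def conj {d : ℕ} (x : X d) : X d := alpha d (MulOpposite.unop (reversal d x))

/-- The norm `N(x) = x x̄`. -/
noncomputable def N {d : ℕ} (x : X d) : X d := x * conj x

/-- The `d+1` elements `e_1, …, e_d, e_{d+1}e_{d+2}` (the product counting as one element). -/
noncomputable def f (d : ℕ) : Fin (d + 1) → X d :=
  Fin.lastCases (ePen d * eLast d) (fun j => e d j.castSucc.castSucc)

/-- The product, in increasing order of indices, of the elements `f d j` with `j ∈ S`.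
It is called an `m`-term when `S` has `m` elements; the empty product is `1`. -/
noncomputable def term (d : ℕ) (S : Finset (Fin (d + 1))) : X d :=
  ((S.sort (· ≤ ·)).map (f d)).prod

/-- The subspace `Z_d^0` of `X_d` generated by `1` and by the products of an even number of distinct
elements from `e_1, …, e_d, e_{d+1}e_{d+2}`. -/
noncomputable def Z (d : ℕ) : Submodule ℝ (X d) :=
  Submodule.span ℝ (Set.range fun S : {S : Finset (Fin (d + 1)) // Even S.card} => term d S)

/-! The products `term d S` are linearly independent. This is shown through the action of `X_d` on
functions on the set of subsets of `{e_1, …, e_{d+2}}`. -/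

/-- A Jordan–Wigner sign. -/
noncomputable def sgn {n : ℕ} (j : Fin n) (S : Finset (Fin n)) : ℝ :=
  ∏ k : Fin n, if k < j ∧ k ∈ S then -1 else 1

/-- The weighted shift by the one-element set `{j}` on functions on subsets. -/
noncomputable def shift {n : ℕ} (j : Fin n) (c : Finset (Fin n) → ℝ) :
    Module.End ℝ (Finset (Fin n) → ℝ) where
  toFun g := fun S => c S * g (symmDiff S {j})
  map_add' g h := by ext S; simp [mul_add]
  map_smul' r g := by ext S; simp; ring

theorem sgn_symmDiff {n : ℕ} (j k : Fin n) (S : Finset (Fin n)) :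
    sgn j (symmDiff S {k}) = (if k < j then -1 else 1) * sgn j S := by
  unfold sgn
  rw [← Finset.mul_prod_erase Finset.univ _ (Finset.mem_univ k),
    ← Finset.mul_prod_erase Finset.univ (fun l => if l < j ∧ l ∈ S then (-1 : ℝ) else 1)
      (Finset.mem_univ k), ← mul_assoc]
  congr 1
  · by_cases h1 : k < j <;> by_cases h2 : k ∈ S <;> simp [h1, h2, Finset.mem_symmDiff]
  · refine Finset.prod_congr rfl fun l hl => ?_
    have : l ≠ k := Finset.ne_of_mem_erase hl
    simp [Finset.mem_symmDiff, this]

theorem sgn_mul_self {n : ℕ} (j : Fin n) (S : Finset (Fin n)) : sgn j S * sgn j S = 1 := by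
  unfold sgn
  rw [← Finset.prod_mul_distrib]
  refine Finset.prod_eq_one fun k _ => ?_
  split_ifs <;> norm_num

/-- The coefficients of the action of the generators. -/
noncomputable def coef (d : ℕ) (j : Fin (d + 2)) (S : Finset (Fin (d + 2))) : ℝ :=
  if j = Fin.last (d + 1) then (if j ∈ S then 1 else 0)
  else sgn j S * (if j ∈ S then 1 else -1)

theorem coef_castSucc (d : ℕ) (j : Fin (d + 1)) (S : Finset (Fin (d + 2))) :
    coef d j.castSucc S = sgn j.castSucc S * (if j.castSucc ∈ S then 1 else -1) := by
  simp [coef, (Fin.castSucc_lt_last j).ne]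

theorem coef_last (d : ℕ) (S : Finset (Fin (d + 2))) :
    coef d (Fin.last (d + 1)) S = if Fin.last (d + 1) ∈ S then 1 else 0 := by
  simp [coef]

theorem mem_symmDiff_singleton {n : ℕ} (j k : Fin n) (S : Finset (Fin n)) :
    j ∈ symmDiff S {k} ↔ (if j = k then j ∉ S else j ∈ S) := by
  by_cases h : j = k <;> simp [Finset.mem_symmDiff, h]

/-- The action of `X_d` on functions on subsets. -/
noncomputable def action (d : ℕ) : X d →ₐ[ℝ] Module.End ℝ (Finset (Fin (d + 2)) → ℝ) :=
  lift (fun j => shift j (coef d j))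
    (by
      intro j k h
      refine LinearMap.ext fun g => funext fun S => ?_
      have h' : j.castSucc ≠ k.castSucc := fun hh => h (Fin.castSucc_injective _ hh)
      change coef d j.castSucc S * (coef d k.castSucc (symmDiff S {j.castSucc}) *
        g (symmDiff (symmDiff S {j.castSucc}) {k.castSucc})) +
        coef d k.castSucc S * (coef d j.castSucc (symmDiff S {k.castSucc}) *
        g (symmDiff (symmDiff S {k.castSucc}) {j.castSucc})) = 0
      rw [symmDiff_right_comm S {k.castSucc}]
      simp only [coef_castSucc, sgn_symmDiff, mem_symmDiff_singleton, h', h'.symm, if_false]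
      rcases lt_or_gt_of_ne h' with hlt | hlt
      · rw [if_pos hlt, if_neg hlt.not_gt]; ring
      · rw [if_pos hlt, if_neg hlt.not_gt]; ring)
    (by
      intro j
      refine LinearMap.ext fun g => funext fun S => ?_
      change coef d j.castSucc S * (coef d j.castSucc (symmDiff S {j.castSucc}) *
        g (symmDiff (symmDiff S {j.castSucc}) {j.castSucc})) + g S = 0
      rw [symmDiff_symmDiff_cancel_right]
      simp only [coef_castSucc, sgn_symmDiff, mem_symmDiff_singleton, lt_irrefl, if_true,
        if_false]
      have := sgn_mul_self j.castSucc S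
      by_cases hS : j.castSucc ∈ S
      · simp only [hS, not_true_eq_false, if_true, if_false]
        linear_combination (-g S) * this
      · simp only [hS, not_false_eq_true, if_true, if_false]
        linear_combination (-g S) * this)
    (by
      refine LinearMap.ext fun g => funext fun S => ?_
      change coef d (Fin.last _) S * (coef d (Fin.last _) (symmDiff S {Fin.last _}) *
        g (symmDiff (symmDiff S {Fin.last _}) {Fin.last _})) = 0
      simp only [coef_last, mem_symmDiff_singleton, if_true]
      by_cases hS : Fin.last (d + 1) ∈ S <;> simp [hS])
    (by
      intro j
      refine LinearMap.ext fun g => funext fun S => ?_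
      have h' : j.castSucc ≠ Fin.last (d + 1) := (Fin.castSucc_lt_last j).ne
      have h'' : ¬ Fin.last (d + 1) < j.castSucc := (Fin.castSucc_lt_last j).not_gt
      change coef d (Fin.last _) S * (coef d j.castSucc (symmDiff S {Fin.last _}) *
        g (symmDiff (symmDiff S {Fin.last _}) {j.castSucc})) -
        coef d j.castSucc S * (coef d (Fin.last _) (symmDiff S {j.castSucc}) *
        g (symmDiff (symmDiff S {j.castSucc}) {Fin.last _})) = 0
      rw [symmDiff_right_comm S {j.castSucc}]
      simp only [coef_castSucc, coef_last, sgn_symmDiff, mem_symmDiff_singleton, h', h'.symm, h'',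
        if_false]
      ring)

theorem action_e_single {d : ℕ} (j : Fin (d + 2)) (S : Finset (Fin (d + 2))) (hj : j ∉ S)
    (hS : ∀ k ∈ S, j < k) :
    action d (e d j) (Pi.single S 1) = Pi.single (insert j S) 1 := by
  have hins : symmDiff (insert j S) {j} = S := by
    ext k
    rw [mem_symmDiff_singleton]
    by_cases h : k = j
    · subst h; simp [hj]
    · simp [h]
  have hc : coef d j (insert j S) = 1 := by
    have hs : sgn j (insert j S) = 1 := by
      refine Finset.prod_eq_one fun k _ => if_neg ?_
      rintro ⟨hk, hk'⟩
      rcases Finset.mem_insert.1 hk' with rfl | h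
      · exact lt_irrefl _ hk
      · exact lt_asymm hk (hS k h)
    simp [coef, hs]
  rw [action, lift_e]
  funext U
  change coef d j U * (Pi.single S (1 : ℝ) : Finset (Fin (d + 2)) → ℝ) (symmDiff U {j}) = _
  by_cases hU : U = insert j S
  · subst hU; rw [hins, hc]; simp
  · have : symmDiff U {j} ≠ S := by
      rintro rfl
      apply hU
      ext k
      by_cases h : k = j
      · subst h; simpa [mem_symmDiff_singleton] using hj
      · simp [mem_symmDiff_singleton, h]
    rw [Pi.single_eq_of_ne this, Pi.single_eq_of_ne hU, mul_zero]

/-- The subset of `{e_1, …, e_{d+2}}` of the factors of `term d S`. -/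
def factors {d : ℕ} (S : Finset (Fin (d + 1))) : Finset (Fin (d + 2)) :=
  S.image Fin.castSucc ∪ (if Fin.last d ∈ S then {Fin.last (d + 1)} else ∅)

theorem castSucc_mem_factors {d : ℕ} (S : Finset (Fin (d + 1))) (j : Fin (d + 1)) :
    j.castSucc ∈ factors S ↔ j ∈ S := by
  have : j.castSucc ≠ Fin.last (d + 1) := (Fin.castSucc_lt_last j).ne
  unfold factors
  split_ifs <;> simp [this]

theorem factors_injective (d : ℕ) : Function.Injective (factors (d := d)) := by
  intro S U h
  ext j
  rw [← castSucc_mem_factors, h, castSucc_mem_factors]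

theorem action_f_single {d : ℕ} (j : Fin (d + 1)) (S : Finset (Fin (d + 1)))
    (hS : ∀ k ∈ S, j < k) :
    action d (f d j) (Pi.single (factors S) 1) = Pi.single (factors (insert j S)) 1 := by
  have hj : j ∉ S := fun h => lt_irrefl _ (hS j h)
  induction j using Fin.lastCases with
  | last =>
    have h0 : S = ∅ := Finset.eq_empty_of_forall_notMem fun k hk =>
      absurd (hS k hk) (Fin.le_last k).not_gt
    subst h0
    have h1 : factors (∅ : Finset (Fin (d + 1))) = ∅ := by simp [factors]
    have h2 : factors (insert (Fin.last d) (∅ : Finset (Fin (d + 1))))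
        = insert (Fin.last d).castSucc {Fin.last (d + 1)} := by
      ext k; simp [factors]
    rw [h1, h2]
    simp only [f, Fin.lastCases_last, map_mul, ePen, eLast]
    change action d _ (action d _ _) = _
    rw [action_e_single _ _ (by simp) (by simp)]
    have h3 : (Fin.last d).castSucc < Fin.last (d + 1) := Fin.castSucc_lt_last _
    have h4 := action_e_single (d := d) (Fin.last d).castSucc {Fin.last (d + 1)}
      (by simp) (by simp)
    simpa using h4
  | cast j =>
    simp only [f, Fin.lastCases_castSucc]
    have hl : Fin.last d ≠ j.castSucc := (Fin.castSucc_lt_last j).ne'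
    rw [action_e_single]
    · congr 1
      simp [factors, hl, Finset.insert_union]
    · rwa [castSucc_mem_factors]
    · intro k hk
      induction k using Fin.lastCases with
      | last => exact Fin.castSucc_lt_last _
      | cast k => exact Fin.castSucc_lt_castSucc_iff.2 (hS k ((castSucc_mem_factors S k).1 hk))

theorem action_list_single {d : ℕ} (l : List (Fin (d + 1))) (hl : l.Pairwise (· < ·)) :
    action d ((l.map (f d)).prod) (Pi.single ∅ 1) = Pi.single (factors l.toFinset) 1 := by
  induction l with
  | nil => simp [factors]
  | cons j l ih =>
    rw [List.pairwise_cons] at hl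
    rw [List.map_cons, List.prod_cons, map_mul]
    change action d _ (action d _ _) = _
    rw [ih hl.2, action_f_single _ _ (by simpa using hl.1), List.toFinset_cons]

theorem action_term {d : ℕ} (S : Finset (Fin (d + 1))) :
    action d (term d S) (Pi.single ∅ 1) = Pi.single (factors S) 1 := by
  rw [term, action_list_single _ (Finset.sortedLT_sort S).pairwise, Finset.sort_toFinset]

theorem linearIndependent_term (d : ℕ) : LinearIndependent ℝ (term d) := by
  let φ : X d →ₗ[ℝ] (Finset (Fin (d + 2)) → ℝ) :=
    (LinearMap.applyₗ (Pi.single ∅ 1)).comp (action d).toLinearMap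
  apply LinearIndependent.of_comp φ
  have h : φ ∘ term d = (Pi.basisFun ℝ (Finset (Fin (d + 2)))) ∘ factors := by
    funext S
    rw [Function.comp_apply, Function.comp_apply, Pi.basisFun_apply]
    exact action_term S
  rw [h]
  exact (Pi.basisFun ℝ _).linearIndependent.comp _ (factors_injective d)

/-- The standard basis of `Z_d^0`, consisting of the `m`-terms with `m` even. It identifies `Z_d^0`
with `ℝ^{2^d}`. -/
noncomputable def zBasis (d : ℕ) :
    Module.Basis {S : Finset (Fin (d + 1)) // Even S.card} ℝ (Z d) :=
  Module.Basis.span ((linearIndependent_term d).comp Subtype.val Subtype.val_injective)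

theorem coe_zBasis (d : ℕ) (S : {S : Finset (Fin (d + 1)) // Even S.card}) :
    (zBasis d S : X d) = term d S := by
  exact congrArg Subtype.val (Module.Basis.span_apply
    ((linearIndependent_term d).comp Subtype.val Subtype.val_injective) S)

/-- The group `Spun(d)`, as a subset of `Z_d^0`. -/
def Spun (d : ℕ) : Set (Z d) :=
  {z | N (z : X d) = 1 ∧ ∀ v : EuclideanSpace ℝ (Fin d), ∃ w : EuclideanSpace ℝ (Fin d),
    (z : X d) * (eLast d * i d v + ePen d) * conj (z : X d) = eLast d * i d w + ePen d}

/-- The set `T_{ap}` of the elements `x` of `Spun(d)` with `a^x = p`, where `w = a^x` is the point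
with `x (e_{d+2} i(a) + e_{d+1}) x̄ = e_{d+2} i(w) + e_{d+1}`. -/
def T {d : ℕ} (a p : EuclideanSpace ℝ (Fin d)) : Set (Z d) :=
  {x | x ∈ Spun d ∧
    (x : X d) * (eLast d * i d a + ePen d) * conj (x : X d) = eLast d * i d p + ePen d}

/-- The first coordinate of `Z_d^0 = ℝ^{2^d}`: the coefficient of `1`. -/
noncomputable def firstCoord {d : ℕ} (x : Z d) : ℝ := (zBasis d).repr x ⟨∅, by simp⟩

/-- The hyperplane `x_1 = 0`. -/
def H0 (d : ℕ) : Set (Z d) := {x | firstCoord x = 0}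

/-- The space `ℝ^{binom(d+1,2)}`, with one coordinate for each 2-term of `Z_d^0`. -/
abbrev PairSpace (d : ℕ) : Type := {S : Finset (Fin (d + 1)) // S.card = 2} → ℝ

theorem finrank_pairSpace (d : ℕ) : Module.finrank ℝ (PairSpace d) = (d + 1).choose 2 := by
  rw [Module.finrank_fintype_fun_eq_card, Fintype.card_finset_len, Fintype.card_fin]

/-- The map `η_d`: scale `x` so that the coefficient of `1` becomes `1`, then keep only the
coefficients of the 2-terms. It is only meaningful outside `H0 d`. -/
noncomputable def eta {d : ℕ} (x : Z d) : PairSpace d :=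
  fun S => (zBasis d).repr ((firstCoord x)⁻¹ • x) ⟨S.1, by rw [S.2]; exact even_two⟩

/-- The flat `L_{ap} = η_d(T_{ap} \ H_0)`. -/
def L {d : ℕ} (a p : EuclideanSpace ℝ (Fin d)) : Set (PairSpace d) := eta '' (T a p \ H0 d)

/-- `s` is a `k`-flat: a nonempty affine subspace of dimension `k`. -/
def IsFlat {V : Type*} [AddCommGroup V] [Module ℝ V] (k : ℕ) (s : Set V) : Prop :=
  ∃ W : AffineSubspace ℝ V, (W : Set V) = s ∧ s.Nonempty ∧ Module.finrank ℝ W.direction = k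

end SpunGroup

namespace SpunGroup

/-! ### Coordinates and the two cyclic functionals -/

/-! The set `L a p` is the solution set of `d` explicit linear equations, and the dimensions then
follow by rank–nullity (`L_eq`, `flatMap`). For `x` in `T a p`, the conjugate is an inverse of `x`,
so the defining condition becomes the linear relation `x * point a = point p * x`. Multiplying it by
a basis vector `ev d k` and reading off the coefficient of `e_{d+2}` gives, after division by the
scalar part, `2 * boost k y + ∑ l, (a + p) l * bivec k l y = (a - p) k` (`trDual_eq_of_mem_T`,
`flatMap_eta`). Each equation determines one boost coordinate from the bivector coordinates.
Conversely, the bivector coordinates are free: every skew matrix is the bivector part of some rotor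
with scalar part `1` (`exists_isRotor`). Composing a normalized rotor with translations from `a` to
`0` and from `0` to `p` gives an element of `T a p` with the same bivector part (`exists_mem_T`),
and the equations then force its boost part. For two flats, subtracting the systems leaves `contract
m y = const` with `m = (a + p) - (b + q)`. A common point and `T a p ≠ T b q` force `m ≠ 0`. By
skewness `contract m y` is orthogonal to `m`, and this is the only dependency, so the joint system
has rank `2d - 1` (`finrank_ker_flatMap_prod_contract`). -/

theorem adjoin_range_e (d : ℕ) : Algebra.adjoin ℝ (Set.range (e d)) = ⊤ := by
  have h : Set.range (e d) = mk d '' Set.range (FreeAlgebra.ι ℝ) := by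
    rw [← Set.range_comp]; rfl
  rw [h, ← AlgHom.map_adjoin, FreeAlgebra.adjoin_range_ι, Algebra.map_top]
  exact (AlgHom.range_eq_top _).2 (RingQuot.mkAlgHom_surjective ℝ (Rel d))

/-- The coefficient of the monomial with index set `T` in an element of `X_d`. -/
noncomputable def coord {d : ℕ} (T : Finset (Fin (d + 2))) : X d →ₗ[ℝ] ℝ :=
  (LinearMap.proj T).comp
    ((LinearMap.applyₗ (Pi.single ∅ 1)).comp (action d).toLinearMap)

theorem coord_apply {d : ℕ} (T : Finset (Fin (d + 2))) (x : X d) :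
    coord T x = action d x (Pi.single ∅ 1) T := rfl

theorem action_e {d : ℕ} (j : Fin (d + 2)) : action d (e d j) = shift j (coef d j) := by
  rw [action, lift_e]

theorem coord_e_mul {d : ℕ} (T : Finset (Fin (d + 2))) (j : Fin (d + 2)) (x : X d) :
    coord T (e d j * x) = coef d j T * coord (symmDiff T {j}) x := by
  rw [coord_apply, map_mul, action_e]; rfl

/-- The operator of right multiplication by a generator other than the last one. -/
noncomputable def rightShift {d : ℕ} (j : Fin (d + 1)) :
    Module.End ℝ (Finset (Fin (d + 2)) → ℝ) :=
  shift j.castSucc fun S => -(sgn j.castSucc S * sgn (Fin.last (d + 1)) S)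

/-- Left and right multiplications commute. Since `sgn (Fin.last (d + 1)) S` counts the members of
`S` other than the last generator, the sign in `rightShift` is that of carrying `e_j` from the right
end past the later generators; the relation `e_j^2 = -1` is covered by the same formula. -/
theorem rightShift_mul_action_e {d : ℕ} (j : Fin (d + 1)) (k : Fin (d + 2)) :
    rightShift j * action d (e d k) = action d (e d k) * rightShift j := by
  rw [action_e]
  refine LinearMap.ext fun g => funext fun S => ?_
  change -(sgn j.castSucc S * sgn (Fin.last (d + 1)) S) *
      (coef d k (symmDiff S {j.castSucc}) * g (symmDiff (symmDiff S {j.castSucc}) {k})) =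
    coef d k S * (-(sgn j.castSucc (symmDiff S {k}) * sgn (Fin.last (d + 1)) (symmDiff S {k})) *
      g (symmDiff (symmDiff S {k}) {j.castSucc}))
  rw [symmDiff_right_comm S {k}]
  have hj : j.castSucc < Fin.last (d + 1) := Fin.castSucc_lt_last j
  induction k using Fin.lastCases with
  | last =>
    simp only [coef_last, sgn_symmDiff, mem_symmDiff_singleton, hj.ne', hj.not_gt, lt_irrefl,
      if_false]
    ring
  | cast k =>
    have hk : k.castSucc < Fin.last (d + 1) := Fin.castSucc_lt_last k
    simp only [coef_castSucc, sgn_symmDiff, mem_symmDiff_singleton, hk, if_true]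
    rcases lt_trichotomy j.castSucc k.castSucc with h | h | h
    · simp only [h, h.ne', h.not_gt, if_true, if_false]; ring
    · rw [h]
      by_cases hS : k.castSucc ∈ S <;>
      · simp only [hS, lt_irrefl, not_true_eq_false, not_false_eq_true, if_true, if_false]; ring
    · simp only [h, h.ne, h.not_gt, if_true, if_false]; ring

theorem rightShift_mul_action {d : ℕ} (j : Fin (d + 1)) (x : X d) :
    rightShift j * action d x = action d x * rightShift j := by
  have hx : x ∈ Algebra.adjoin ℝ (Set.range (e d)) := by rw [adjoin_range_e]; trivial
  induction hx using Algebra.adjoin_induction with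
  | mem x hx => obtain ⟨k, rfl⟩ := hx; exact rightShift_mul_action_e j k
  | algebraMap r => rw [AlgHom.commutes]; exact (Algebra.commutes r _).symm
  | add x y _ _ hx hy => rw [map_add, mul_add, add_mul, hx, hy]
  | mul x y _ _ hx hy => rw [map_mul, ← mul_assoc, hx, mul_assoc, hy, mul_assoc]

theorem sgn_empty {n : ℕ} (j : Fin n) : sgn j ∅ = 1 := by simp [sgn]

theorem sgn_singleton {n : ℕ} (j k : Fin n) : sgn j {k} = if k < j then -1 else 1 := by
  rw [← bot_symmDiff ({k} : Finset (Fin n)), sgn_symmDiff, Finset.bot_eq_empty, sgn_empty, mul_one]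

theorem rightShift_single {d : ℕ} (j : Fin (d + 1)) :
    rightShift j (Pi.single ∅ 1) = action d (e d j.castSucc) (Pi.single ∅ 1) := by
  rw [action_e]
  funext S
  change -(sgn j.castSucc S * sgn (Fin.last (d + 1)) S) *
    (Pi.single ∅ (1 : ℝ) : Finset (Fin (d + 2)) → ℝ) (symmDiff S {j.castSucc}) =
    coef d j.castSucc S *
    (Pi.single ∅ (1 : ℝ) : Finset (Fin (d + 2)) → ℝ) (symmDiff S {j.castSucc})
  by_cases h : S = {j.castSucc}
  · subst h
    rw [coef_castSucc, sgn_singleton, sgn_singleton, if_pos (Fin.castSucc_lt_last j)]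
    simp
  · have : symmDiff S {j.castSucc} ≠ ∅ := fun h' => h (symmDiff_eq_bot.1 h')
    rw [Pi.single_eq_of_ne this, mul_zero, mul_zero]

/-- On the vector `Pi.single ∅ 1`, which represents `1`, left and right multiplication by a
generator agree; the right one can then be pulled out past the action of `x`. -/
theorem coord_mul_e {d : ℕ} (T : Finset (Fin (d + 2))) (j : Fin (d + 1)) (x : X d) :
    coord T (x * e d j.castSucc) =
      -(sgn j.castSucc T * sgn (Fin.last (d + 1)) T) * coord (symmDiff T {j.castSucc}) x := by
  rw [coord_apply, map_mul, Module.End.mul_apply, ← rightShift_single, ← Module.End.mul_apply,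
    ← rightShift_mul_action]
  rfl

theorem eLast_mul_comm {d : ℕ} (x : X d) : eLast d * x = x * eLast d := by
  have hx : x ∈ Algebra.adjoin ℝ (Set.range (e d)) := by rw [adjoin_range_e]; trivial
  induction hx using Algebra.adjoin_induction with
  | mem x hx =>
    obtain ⟨k, rfl⟩ := hx
    induction k using Fin.lastCases with
    | last => rfl
    | cast k => exact sub_eq_zero.1 (e_lastComm d k)
  | algebraMap r => exact (Algebra.commutes r _).symm
  | add x y _ _ hx hy => rw [mul_add, add_mul, hx, hy]
  | mul x y _ _ hx hy => rw [← mul_assoc, hx, mul_assoc, hy, mul_assoc]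

/-- Cyclicity passes to sums and products of `y`, so generators suffice. For a generator outside
`T`, the signs of left and right multiplication coincide at `T`, because `T` contains nothing but
possibly the central `e_{d+2}`. -/
theorem coord_mul_comm {d : ℕ} {T : Finset (Fin (d + 2))} (hT : T ⊆ {Fin.last (d + 1)})
    (x y : X d) : coord T (x * y) = coord T (y * x) := by
  have hy : y ∈ Algebra.adjoin ℝ (Set.range (e d)) := by rw [adjoin_range_e]; trivial
  induction hy using Algebra.adjoin_induction generalizing x with
  | mem y hy =>
    obtain ⟨k, rfl⟩ := hy
    induction k using Fin.lastCases with
    | last => exact congrArg _ (eLast_mul_comm x).symm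
    | cast k =>
      have hk : k.castSucc ∉ T := fun h =>
        (Fin.castSucc_lt_last k).ne (Finset.mem_singleton.1 (hT h))
      have h1 : sgn (Fin.last (d + 1)) T = 1 := by
        refine Finset.prod_eq_one fun l _ => if_neg ?_
        rintro ⟨hl, hl'⟩
        exact hl.ne (Finset.mem_singleton.1 (hT hl'))
      rw [coord_mul_e, coord_e_mul, coef_castSucc, if_neg hk, h1]
      ring
  | algebraMap r => rw [Algebra.commutes]
  | add y z _ _ hy hz => rw [mul_add, add_mul, map_add, map_add, hy, hz]
  | mul y z _ _ hy hz => rw [← mul_assoc, hz, ← mul_assoc, hy, mul_assoc]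

/-- The scalar part. -/
noncomputable def tr (d : ℕ) : X d →ₗ[ℝ] ℝ := coord ∅

/-- The coefficient of the last generator. -/
noncomputable def trDual (d : ℕ) : X d →ₗ[ℝ] ℝ := coord {Fin.last (d + 1)}

theorem tr_mul_comm {d : ℕ} (x y : X d) : tr d (x * y) = tr d (y * x) :=
  coord_mul_comm (by simp) x y

theorem trDual_mul_comm {d : ℕ} (x y : X d) : trDual d (x * y) = trDual d (y * x) :=
  coord_mul_comm (by simp) x y

theorem tr_one (d : ℕ) : tr d 1 = 1 := by
  simp [tr, coord_apply]

theorem tr_eLast_mul {d : ℕ} (x : X d) : tr d (eLast d * x) = 0 := by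
  rw [tr, eLast, coord_e_mul, coef_last]; simp

theorem trDual_eLast_mul {d : ℕ} (x : X d) : trDual d (eLast d * x) = tr d x := by
  rw [trDual, eLast, coord_e_mul, coef_last]; simp [tr]

/-! ### The basis vectors of `ℝ^d` inside `X_d` -/

/-- The image in `X_d` of the `j`-th basis vector. -/
noncomputable def ev (d : ℕ) (j : Fin d) : X d := e d j.castSucc.castSucc

theorem i_apply {d : ℕ} (v : EuclideanSpace ℝ (Fin d)) : i d v = ∑ j, v j • ev d j := rfl

theorem i_single {d : ℕ} (j : Fin d) : i d (EuclideanSpace.single j 1) = ev d j := by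
  rw [i_apply, Finset.sum_eq_single j] <;> simp +contextual

theorem ev_anticomm {d : ℕ} {j k : Fin d} (h : j ≠ k) : ev d j * ev d k = -(ev d k * ev d j) :=
  eq_neg_of_add_eq_zero_left (e_anticomm d _ _ fun h' => h (Fin.castSucc_injective _ h'))

theorem ev_sq {d : ℕ} (j : Fin d) : ev d j * ev d j = -1 :=
  eq_neg_of_add_eq_zero_left (e_sq d _)

theorem ePen_sq (d : ℕ) : ePen d * ePen d = -1 := eq_neg_of_add_eq_zero_left (e_sq d _)

theorem eLast_sq (d : ℕ) : eLast d * eLast d = 0 := e_lastSq d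

theorem ev_mul_ePen {d : ℕ} (j : Fin d) : ev d j * ePen d = -(ePen d * ev d j) :=
  eq_neg_of_add_eq_zero_left (e_anticomm d _ _ (Fin.castSucc_lt_last j).ne)

theorem i_mul_ePen {d : ℕ} (v : EuclideanSpace ℝ (Fin d)) :
    i d v * ePen d = -(ePen d * i d v) := by
  rw [i_apply, Finset.sum_mul, Finset.mul_sum, ← Finset.sum_neg_distrib]
  refine Finset.sum_congr rfl fun j _ => ?_
  rw [smul_mul_assoc, mul_smul_comm, ev_mul_ePen, smul_neg]

theorem i_mul_ev_add {d : ℕ} (v : EuclideanSpace ℝ (Fin d)) (k : Fin d) :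
    i d v * ev d k + ev d k * i d v = (-2 * v k) • (1 : X d) := by
  rw [i_apply, Finset.sum_mul, Finset.mul_sum, ← Finset.sum_add_distrib,
    Finset.sum_eq_single k]
  · rw [smul_mul_assoc, mul_smul_comm, ev_sq]
    module
  · intro j _ hj
    rw [smul_mul_assoc, mul_smul_comm, ev_anticomm hj, smul_neg, neg_add_cancel]
  · simp

theorem i_mul_i_add {d : ℕ} (u v : EuclideanSpace ℝ (Fin d)) :
    i d u * i d v + i d v * i d u = (-2 * ∑ k, u k * v k) • (1 : X d) := by
  rw [i_apply v, Finset.sum_mul, Finset.mul_sum, ← Finset.sum_add_distrib, Finset.mul_sum,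
    Finset.sum_smul]
  refine Finset.sum_congr rfl fun k _ => ?_
  rw [smul_mul_assoc, mul_smul_comm, ← smul_add, i_mul_ev_add, smul_smul]
  congr 1; ring

theorem i_mul_self {d : ℕ} (u : EuclideanSpace ℝ (Fin d)) :
    i d u * i d u = (-∑ k, u k * u k) • (1 : X d) := by
  have h := i_mul_i_add u u
  rw [← two_smul ℝ (i d u * i d u)] at h
  rw [← one_smul ℝ (i d u * i d u), show (1 : ℝ) = 2⁻¹ * 2 by norm_num, mul_smul, h, smul_smul]
  congr 1; ring

/-- Up to sign and scale, this is the reflection in the hyperplane orthogonal to `u`. -/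
theorem i_sandwich {d : ℕ} (u v : EuclideanSpace ℝ (Fin d)) :
    ∃ w, i d u * i d v * i d u = i d w := by
  refine ⟨(∑ k, u k * u k) • v - (2 * ∑ k, u k * v k) • u, ?_⟩
  have h : i d u * i d v = (-2 * ∑ k, u k * v k) • (1 : X d) - i d v * i d u :=
    eq_sub_of_add_eq (i_mul_i_add u v)
  rw [h, sub_mul, mul_assoc, i_mul_self, map_sub, map_smul, map_smul, smul_mul_assoc, one_mul,
    mul_smul_comm, mul_one]
  module

/-! ### The coordinates of `Z_d^0` as traces -/

theorem coord_term {d : ℕ} (S U : Finset (Fin (d + 1))) :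
    coord (factors S) (term d U) = if U = S then 1 else 0 := by
  rw [coord_apply, action_term, Pi.single_apply]
  simp only [(factors_injective d).eq_iff, eq_comm]

theorem repr_zBasis {d : ℕ} (z : Z d) (S : {S : Finset (Fin (d + 1)) // Even S.card}) :
    (zBasis d).repr z S = coord (factors S.1) (z : X d) := by
  have h : (Finsupp.lapply S).comp (zBasis d).repr.toLinearMap =
      (coord (factors S.1)).comp (Z d).subtype := by
    refine (zBasis d).ext fun U => ?_
    simp [coe_zBasis, coord_term, Finsupp.single_apply, Subtype.ext_iff]
  exact LinearMap.congr_fun h z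

theorem firstCoord_eq {d : ℕ} (z : Z d) : firstCoord z = tr d z := by
  rw [firstCoord, repr_zBasis]
  simp [factors, tr]

/-- The order is reversed because `ev d k * ev d j` is the inverse of `ev d j * ev d k`. -/
theorem tr_ev_ev {d : ℕ} {j k : Fin d} (h : j < k) (x : X d) :
    tr d (ev d k * ev d j * x) = coord (factors {j.castSucc, k.castSucc}) x := by
  have h1 : j.castSucc.castSucc ≠ k.castSucc.castSucc := by simpa using h.ne
  have h2 : ¬ k.castSucc.castSucc < j.castSucc.castSucc := by simpa using h.le
  have hf : factors {j.castSucc, k.castSucc} =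
      symmDiff (symmDiff ∅ {k.castSucc.castSucc}) {j.castSucc.castSucc} := by
    ext l
    have := (Fin.castSucc_lt_last j).ne'
    have := (Fin.castSucc_lt_last k).ne'
    by_cases hl : l = j.castSucc.castSucc <;>
      simp_all [factors, Finset.mem_symmDiff]
  have hm : j.castSucc.castSucc ∉ symmDiff (∅ : Finset (Fin (d + 2))) {k.castSucc.castSucc} := by
    rw [mem_symmDiff_singleton, if_neg h1]
    exact Finset.notMem_empty _
  rw [mul_assoc, tr, ev, ev, coord_e_mul, coord_e_mul, hf, coef_castSucc, coef_castSucc,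
    sgn_symmDiff, if_neg h2, sgn_empty, sgn_empty, if_neg (Finset.notMem_empty _), if_neg hm]
  ring

/-- The 2-term here is `e_k e_{d+1} e_{d+2}`; multiplying it by `e_{d+1} e_k` leaves `e_{d+2}`,
hence the dual trace. -/
theorem trDual_ePen_ev {d : ℕ} (k : Fin d) (x : X d) :
    trDual d (ePen d * ev d k * x) = coord (factors {k.castSucc, Fin.last d}) x := by
  have h1 : k.castSucc.castSucc < (Fin.last d).castSucc := by simp
  have h2 : k.castSucc.castSucc < Fin.last (d + 1) := Fin.castSucc_lt_last _
  have h3 : (Fin.last d).castSucc < Fin.last (d + 1) := Fin.castSucc_lt_last _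
  have hf : factors {k.castSucc, Fin.last d} =
      symmDiff (symmDiff {Fin.last (d + 1)} {(Fin.last d).castSucc}) {k.castSucc.castSucc} := by
    ext l
    rw [mem_symmDiff_singleton, mem_symmDiff_singleton]
    by_cases hl : l = k.castSucc.castSucc
    · subst hl
      simp [factors, h1.ne, h2.ne]
    · by_cases hl' : l = (Fin.last d).castSucc <;> simp_all [factors, h3.ne]
  have hs : ∀ j : Fin (d + 2), sgn j {Fin.last (d + 1)} = 1 :=
    fun j => by rw [sgn_singleton, if_neg (Fin.le_last j).not_gt]
  have hm : k.castSucc.castSucc ∉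
      symmDiff ({Fin.last (d + 1)} : Finset (Fin (d + 2))) {(Fin.last d).castSucc} := by
    rw [mem_symmDiff_singleton, if_neg h1.ne]
    simp
  rw [mul_assoc, trDual, ePen, ev, coord_e_mul, coord_e_mul, hf, coef_castSucc, coef_castSucc,
    sgn_symmDiff, if_neg h1.not_gt, hs, hs, if_neg (by simp), if_neg hm]
  ring

theorem tr_ev_ev_swap {d : ℕ} {j k : Fin d} (h : j ≠ k) (x : X d) :
    tr d (ev d k * ev d j * x) = -tr d (ev d j * ev d k * x) := by
  rw [ev_anticomm h, neg_mul, map_neg, neg_neg]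

theorem tr_ev_ev_self {d : ℕ} (j : Fin d) (x : X d) :
    tr d (ev d j * ev d j * x) = -tr d x := by
  rw [ev_sq, neg_one_mul, map_neg]

/-! ### Conjugation -/

theorem conj_mul {d : ℕ} (x y : X d) : conj (x * y) = conj y * conj x := by
  simp [conj]

theorem conj_add {d : ℕ} (x y : X d) : conj (x + y) = conj x + conj y := by
  simp [conj]

theorem conj_smul {d : ℕ} (c : ℝ) (x : X d) : conj (c • x) = c • conj x := by
  simp [conj]

theorem conj_one (d : ℕ) : conj (1 : X d) = 1 := by
  simp [conj]

theorem conj_e_castSucc {d : ℕ} (j : Fin (d + 1)) : conj (e d j.castSucc) = -e d j.castSucc := by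
  rw [conj, reversal, lift_e, MulOpposite.unop_op, alpha, lift_e, Fin.lastCases_castSucc]

theorem conj_eLast (d : ℕ) : conj (eLast d) = eLast d := by
  rw [conj, reversal, eLast, lift_e, MulOpposite.unop_op, alpha, lift_e, Fin.lastCases_last]

theorem conj_ev {d : ℕ} (j : Fin d) : conj (ev d j) = -ev d j := conj_e_castSucc _

theorem conj_ePen (d : ℕ) : conj (ePen d) = -ePen d := conj_e_castSucc _

theorem conj_i {d : ℕ} (v : EuclideanSpace ℝ (Fin d)) : conj (i d v) = -i d v := by
  let c : X d →ₗ[ℝ] X d :=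
    { toFun := conj, map_add' := conj_add, map_smul' := conj_smul }
  change c (i d v) = _
  rw [i_apply, map_sum, ← Finset.sum_neg_distrib]
  refine Finset.sum_congr rfl fun j _ => ?_
  rw [map_smul, ← smul_neg]
  exact congrArg _ (conj_ev j)

/-! ### Elements stabilizing `Z_d^0` -/

theorem f_castSucc {d : ℕ} (j : Fin d) : f d j.castSucc = ev d j := by simp [f, ev]

theorem f_last (d : ℕ) : f d (Fin.last d) = ePen d * eLast d := by simp [f]

theorem f_anticomm {d : ℕ} {j k : Fin (d + 1)} (h : j ≠ k) :
    f d j * f d k = -(f d k * f d j) := by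
  induction j using Fin.lastCases with
  | last =>
    induction k using Fin.lastCases with
    | last => exact absurd rfl h
    | cast k =>
      rw [f_castSucc, f_last, mul_assoc, eLast_mul_comm, ← mul_assoc, ← mul_assoc, ev_mul_ePen,
        neg_mul, neg_neg]
  | cast j =>
    induction k using Fin.lastCases with
    | last =>
      rw [f_castSucc, f_last, mul_assoc, eLast_mul_comm, ← mul_assoc, ← mul_assoc, ev_mul_ePen,
        neg_mul]
    | cast k =>
      rw [f_castSucc, f_castSucc, ev_anticomm fun h' => h (congrArg _ h')]

theorem exists_f_sq {d : ℕ} (j : Fin (d + 1)) : ∃ c : ℝ, f d j * f d j = c • 1 := by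
  induction j using Fin.lastCases with
  | last =>
    refine ⟨0, ?_⟩
    rw [f_last, mul_assoc, ← mul_assoc (eLast d), eLast_mul_comm, mul_assoc (ePen d), eLast_sq]
    simp
  | cast j => exact ⟨-1, by rw [f_castSucc, ev_sq, neg_one_smul]⟩

/-- Insertion by anticommutation: `f d j` moves right until it reaches its place or meets its own
copy and cancels to a scalar. That scalar is `0` for the nilpotent last element. The length changes
by one either way, so parity flips. -/
theorem exists_f_mul_prod {d : ℕ} (j : Fin (d + 1)) (l : List (Fin (d + 1)))
    (hl : l.Pairwise (· < ·)) :
    ∃ (c : ℝ) (l' : List (Fin (d + 1))), l'.Pairwise (· < ·) ∧ (∀ k ∈ l', k = j ∨ k ∈ l) ∧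
      (Even l'.length ↔ ¬ Even l.length) ∧ f d j * (l.map (f d)).prod = c • (l'.map (f d)).prod := by
  induction l with
  | nil => exact ⟨1, [j], by simp, by simp, by simp, by simp⟩
  | cons k l ih =>
    rw [List.pairwise_cons] at hl
    rcases lt_trichotomy j k with h | h | h
    · refine ⟨1, j :: k :: l, ?_, by simp, ?_, by simp⟩
      · rw [List.pairwise_cons, List.pairwise_cons]
        refine ⟨fun m hm => ?_, hl⟩
        rcases List.mem_cons.1 hm with rfl | hm
        · exact h
        · exact h.trans (hl.1 m hm)
      · rw [List.length_cons, Nat.even_add_one]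
    · subst h
      obtain ⟨c, hc⟩ := exists_f_sq j
      refine ⟨c, l, hl.2, fun m hm => Or.inr (List.mem_cons_of_mem _ hm), ?_, ?_⟩
      · rw [List.length_cons, Nat.even_add_one, not_not]
      · rw [List.map_cons, List.prod_cons, ← mul_assoc, hc, smul_mul_assoc, one_mul]
    · obtain ⟨c, l', h1, h2, h3, h4⟩ := ih hl.2
      refine ⟨-c, k :: l', ?_, ?_, ?_, ?_⟩
      · rw [List.pairwise_cons]
        refine ⟨fun m hm => ?_, h1⟩
        rcases h2 m hm with rfl | hm
        · exact h
        · exact hl.1 m hm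
      · intro m hm
        rcases List.mem_cons.1 hm with rfl | hm
        · simp
        · rcases h2 m hm with hm | hm <;> simp [hm]
      · rw [List.length_cons, List.length_cons, Nat.even_add_one, Nat.even_add_one, h3]
      · rw [List.map_cons, List.prod_cons, List.map_cons, List.prod_cons, ← mul_assoc,
          f_anticomm h.ne', neg_mul, mul_assoc, h4, mul_smul_comm, neg_smul]

theorem exists_f_mul_term {d : ℕ} (j : Fin (d + 1)) (S : Finset (Fin (d + 1))) :
    ∃ (c : ℝ) (U : Finset (Fin (d + 1))), (Even U.card ↔ ¬ Even S.card) ∧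
      f d j * term d S = c • term d U := by
  obtain ⟨c, l, h1, -, h3, h4⟩ := exists_f_mul_prod j _ (Finset.sortedLT_sort S).pairwise
  have hU : l.toFinset.sort (· ≤ ·) = l :=
    (List.toFinset_sort (· ≤ ·) (h1.imp ne_of_lt)).2 (h1.imp le_of_lt)
  refine ⟨c, l.toFinset, ?_, ?_⟩
  · rw [← Finset.length_sort (· ≤ ·), hU, h3, Finset.length_sort]
  · rw [term, term, h4, hU]

theorem one_mem_Z (d : ℕ) : (1 : X d) ∈ Z d := by
  refine Submodule.subset_span ⟨⟨∅, by simp⟩, ?_⟩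
  simp [term]

theorem f_mul_f_mul_mem_Z {d : ℕ} (j k : Fin (d + 1)) {z : X d} (hz : z ∈ Z d) :
    f d j * f d k * z ∈ Z d := by
  induction hz using Submodule.span_induction with
  | mem z hz =>
    obtain ⟨S, rfl⟩ := hz
    obtain ⟨c, U, hU, h⟩ := exists_f_mul_term k S.1
    obtain ⟨c', U', hU', h'⟩ := exists_f_mul_term j U
    rw [mul_assoc, h, mul_smul_comm, h']
    refine Submodule.smul_mem _ _ (Submodule.smul_mem _ _ (Submodule.subset_span ⟨⟨U', ?_⟩, rfl⟩))
    rw [hU', hU, not_not]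
    exact S.2
  | zero => rw [mul_zero]; exact zero_mem _
  | add x y _ _ hx hy => rw [mul_add]; exact add_mem hx hy
  | smul c x _ hx => rw [mul_smul_comm]; exact Submodule.smul_mem _ _ hx

/-- The algebra of the elements of `X_d` whose left multiplication preserves `Z_d^0`. -/
noncomputable def stab (d : ℕ) : Subalgebra ℝ (X d) where
  carrier := {y | ∀ z ∈ Z d, y * z ∈ Z d}
  mul_mem' hx hy z hz := by rw [mul_assoc]; exact hx _ (hy z hz)
  add_mem' hx hy z hz := by rw [add_mul]; exact add_mem (hx z hz) (hy z hz)
  algebraMap_mem' r z hz := by rw [← Algebra.smul_def]; exact Submodule.smul_mem _ _ hz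

/-- Membership in `Z d` is obtained through `stab d`, which is closed under products by
construction. -/
theorem stab_le_Z {d : ℕ} {y : X d} (hy : y ∈ stab d) : y ∈ Z d := by
  simpa using hy 1 (one_mem_Z d)

theorem i_mul_f_mem_stab {d : ℕ} (w : EuclideanSpace ℝ (Fin d)) (k : Fin (d + 1)) :
    i d w * f d k ∈ stab d := by
  rw [i_apply, Finset.sum_mul]
  refine sum_mem fun j _ => ?_
  rw [smul_mul_assoc, ← f_castSucc]
  exact (stab d).smul_mem (fun z hz => f_mul_f_mul_mem_Z _ _ hz) _

/-! ### Rotors with a prescribed bivector part -/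

/-- For skew `M` the vector `M w` is orthogonal to `w`, so `w = M w` forces `w = 0`; thus `1 - M` is
injective, hence surjective. -/
theorem exists_eq_sub_skew {n : ℕ} (M : Fin n → Fin n → ℝ) (hM : ∀ j k, M j k = -M k j)
    (b : Fin n → ℝ) : ∃ w : Fin n → ℝ, ∀ j, w j - ∑ l, M j l * w l = b j := by
  let φ : (Fin n → ℝ) →ₗ[ℝ] (Fin n → ℝ) := LinearMap.id - (Matrix.of M).mulVecLin
  have hφ : ∀ w j, φ w j = w j - ∑ l, M j l * w l := fun w j => rfl
  have hinj : Function.Injective φ := by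
    rw [← LinearMap.ker_eq_bot, LinearMap.ker_eq_bot']
    intro w hw
    have h1 : ∑ j, w j * ∑ l, M j l * w l = 0 := by
      have h2 : ∑ j, w j * ∑ l, M j l * w l = -∑ j, w j * ∑ l, M j l * w l := by
        simp only [Finset.mul_sum]
        conv_lhs => rw [Finset.sum_comm]
        rw [← Finset.sum_neg_distrib]
        refine Finset.sum_congr rfl fun j _ => ?_
        rw [← Finset.sum_neg_distrib]
        refine Finset.sum_congr rfl fun l _ => ?_
        rw [hM l j]; ring
      linarith
    have h3 : ∑ j, w j * w j = 0 := by
      have : ∑ j, w j * φ w j = 0 := by rw [hw]; simp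
      simp only [hφ, mul_sub, Finset.sum_sub_distrib, h1, sub_zero] at this
      exact this
    funext j
    exact mul_self_eq_zero.1
      ((Finset.sum_eq_zero_iff_of_nonneg fun j _ => mul_self_nonneg _).1 h3 j (Finset.mem_univ j))
  obtain ⟨w, hw⟩ := (LinearMap.injective_iff_surjective.1 hinj) b
  exact ⟨w, fun j => by rw [← hφ, hw]⟩

theorem i_mul_ev_anticomm {d : ℕ} {w : EuclideanSpace ℝ (Fin d)} {k : Fin d} (hw : w k = 0) :
    i d w * ev d k = -(ev d k * i d w) := by
  have h := i_mul_ev_add w k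
  rw [hw, mul_zero, zero_smul] at h
  exact eq_neg_of_add_eq_zero_left h

theorem one_add_mul_conj {d : ℕ} {w : EuclideanSpace ℝ (Fin d)} {k : Fin d} (hw : w k = 0) :
    (1 + i d w * ev d k) * conj (1 + i d w * ev d k) = (1 + ∑ j, w j * w j) • (1 : X d) := by
  have h1 : i d w * ev d k * (ev d k * i d w) = (∑ j, w j * w j) • (1 : X d) := by
    rw [mul_assoc, ← mul_assoc (ev d k), ev_sq, neg_one_mul, mul_neg, i_mul_self, neg_smul, neg_neg]
  rw [conj_add, conj_one, conj_mul, conj_i, conj_ev, neg_mul_neg, mul_add, mul_one, add_mul, one_mul,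
    h1, i_mul_ev_anticomm hw, add_smul, one_smul]
  abel

/-- As `ev d k` squares to `-1`, `1 + w e_k = (w - e_k) e_k` is a product of two vectors, and two
applications of `i_sandwich` suffice. -/
theorem one_add_sandwich {d : ℕ} (w : EuclideanSpace ℝ (Fin d)) (k : Fin d)
    (v : EuclideanSpace ℝ (Fin d)) :
    ∃ u, (1 + i d w * ev d k) * i d v * conj (1 + i d w * ev d k) = i d u := by
  obtain ⟨u, hu⟩ := i_sandwich (EuclideanSpace.single k 1) v
  obtain ⟨u', hu'⟩ := i_sandwich (w - EuclideanSpace.single k 1) u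
  refine ⟨u', ?_⟩
  rw [← hu', ← hu, map_sub, i_single, conj_add, conj_one, conj_mul, conj_i, conj_ev, neg_mul_neg]
  have h1 : 1 + i d w * ev d k = (i d w - ev d k) * ev d k := by
    rw [sub_mul, ev_sq]; abel
  have h2 : 1 + ev d k * i d w = ev d k * (i d w - ev d k) := by
    rw [mul_sub, ev_sq]; abel
  rw [h1, h2]
  simp only [mul_assoc]

/-- A rotor, up to a scalar factor, in the algebra generated by the first `k` basis vectors, with
scalar part `1`. -/
structure IsRotor {d : ℕ} (k : ℕ) (s : X d) : Prop where
  mem_stab : s ∈ stab d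
  commute_ePen : Commute s (ePen d)
  commute_ev : ∀ l : Fin d, k ≤ l → Commute s (ev d l)
  tr_eq_one : tr d s = 1
  mul_conj : ∃ c : ℝ, 0 < c ∧ s * conj s = c • 1
  sandwich : ∀ v, ∃ w, s * i d v * conj s = i d w

theorem isRotor_one (d : ℕ) : IsRotor 0 (1 : X d) where
  mem_stab := one_mem _
  commute_ePen := Commute.one_left _
  commute_ev _ _ := Commute.one_left _
  tr_eq_one := tr_one d
  mul_conj := ⟨1, one_pos, by rw [conj_one, mul_one, one_smul]⟩
  sandwich v := ⟨v, by rw [conj_one, mul_one, one_mul]⟩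

theorem tr_mul_ev_eq_zero {d : ℕ} {k : Fin d} {y : X d} (h : y * ev d k = -(ev d k * y)) :
    tr d (y * ev d k) = 0 := by
  have h1 := tr_mul_comm y (ev d k)
  rw [h, map_neg] at h1 ⊢
  linarith

theorem IsRotor.mul_i_anticomm {d : ℕ} {k : Fin d} {s : X d} (hs : IsRotor k s)
    {w : EuclideanSpace ℝ (Fin d)} (hw : w k = 0) :
    s * i d w * ev d k = -(ev d k * (s * i d w)) := by
  rw [mul_assoc, i_mul_ev_anticomm hw, mul_neg, ← mul_assoc, (hs.commute_ev k le_rfl).eq, mul_assoc]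

theorem IsRotor.mul_one_add {d : ℕ} {k : Fin d} {s : X d} (hs : IsRotor k s)
    {w : EuclideanSpace ℝ (Fin d)} (hw : ∀ l : Fin d, k ≤ l → w l = 0) :
    IsRotor (k + 1) (s * (1 + i d w * ev d k)) where
  mem_stab := by
    refine mul_mem hs.mem_stab (add_mem (one_mem _) ?_)
    rw [← f_castSucc]
    exact i_mul_f_mem_stab _ _
  commute_ePen := by
    refine hs.commute_ePen.mul_left ((Commute.one_left _).add_left ?_)
    change i d w * ev d k * ePen d = ePen d * (i d w * ev d k)
    rw [mul_assoc, ev_mul_ePen, mul_neg, ← mul_assoc, i_mul_ePen, neg_mul, neg_neg, mul_assoc]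
  commute_ev l hl := by
    have hkl : k < l := Fin.lt_def.2 hl
    refine (hs.commute_ev l (by omega)).mul_left ((Commute.one_left _).add_left ?_)
    change i d w * ev d k * ev d l = ev d l * (i d w * ev d k)
    rw [mul_assoc, ev_anticomm hkl.ne, mul_neg, ← mul_assoc, i_mul_ev_anticomm (hw l hkl.le),
      neg_mul, neg_neg, mul_assoc]
  tr_eq_one := by
    rw [mul_add, mul_one, map_add, hs.tr_eq_one, ← mul_assoc,
      tr_mul_ev_eq_zero (hs.mul_i_anticomm (hw k le_rfl)), add_zero]
  mul_conj := by
    obtain ⟨c, hc, h⟩ := hs.mul_conj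
    have hpos : 0 ≤ ∑ j, w j * w j := Finset.sum_nonneg fun j _ => mul_self_nonneg _
    refine ⟨(1 + ∑ j, w j * w j) * c, by positivity, ?_⟩
    rw [conj_mul, mul_assoc, ← mul_assoc (1 + _), one_add_mul_conj (hw k le_rfl), smul_mul_assoc,
      one_mul, mul_smul_comm, h, smul_smul]
  sandwich v := by
    obtain ⟨u, hu⟩ := one_add_sandwich w k v
    obtain ⟨u', hu'⟩ := hs.sandwich u
    refine ⟨u', ?_⟩
    rw [← hu', ← hu, conj_mul]
    simp only [mul_assoc]

/-- Basis vectors are added one at a time: `s` is replaced by `s (1 + w e_k)` with `w` in the span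
of the earlier ones. This keeps the old bivector coefficients, and the new ones are `(1 - B) w`,
with `B` the skew matrix of bivector coefficients of `s`; so `w` can be solved for. -/
theorem exists_isRotor {d : ℕ} (M : Fin d → Fin d → ℝ) (k : ℕ) (hk : k ≤ d) :
    ∃ s : X d, IsRotor k s ∧
      ∀ j l : Fin d, j < l → (l : ℕ) < k → tr d (ev d l * ev d j * s) = M j l := by
  induction k with
  | zero => exact ⟨1, isRotor_one d, fun _ _ _ h => absurd h (Nat.not_lt_zero _)⟩
  | succ n ih =>
    obtain ⟨s, hs, hsM⟩ := ih (by omega)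
    obtain ⟨k, rfl⟩ : ∃ k : Fin d, (k : ℕ) = n := ⟨⟨n, hk⟩, rfl⟩
    -- The diagonal is removed since `tr (e_j e_j s) = -1` would break skewness; it returns later as
    -- the term `w j`. Cutting to indices below `k` forces `w` to vanish from `k` on.
    obtain ⟨w, hw⟩ := exists_eq_sub_skew
      (fun j l => if j < k ∧ l < k ∧ j ≠ l then tr d (ev d l * ev d j * s) else 0)
      (fun j l => by
        by_cases h : j < k ∧ l < k ∧ j ≠ l
        · rw [if_pos h, if_pos ⟨h.2.1, h.1, h.2.2.symm⟩, tr_ev_ev_swap h.2.2]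
        · rw [if_neg h, if_neg fun h' => h ⟨h'.2.1, h'.1, h'.2.2.symm⟩, neg_zero])
      (fun j => if j < k then M j k else 0)
    have hw0 : ∀ l, k ≤ l → w l = 0 := by
      intro l hl
      simpa [hl.not_gt] using hw l
    let w' : EuclideanSpace ℝ (Fin d) := WithLp.toLp 2 w
    have hanti := hs.mul_i_anticomm (w := w') (hw0 k le_rfl)
    refine ⟨s * (1 + i d w' * ev d k), hs.mul_one_add hw0, fun j l hjl hl => ?_⟩
    rw [mul_add, mul_one, ← mul_assoc s, mul_add, map_add]
    rcases (Nat.lt_succ_iff.1 hl).lt_or_eq with hlk | hlk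
    · have hlk' : l ≠ k := Fin.ne_of_lt hlk
      have hjk' : j ≠ k := (hjl.trans hlk).ne
      -- Both old vectors and `s w` anticommute with `e_k`, so the product does too and the trace is
      -- zero by cyclicity.
      have h : tr d (ev d l * ev d j * (s * i d w') * ev d k) = 0 := by
        refine tr_mul_ev_eq_zero ?_
        rw [mul_assoc, hanti, mul_neg, ← mul_assoc, mul_assoc (ev d l), ev_anticomm hjk', mul_neg,
          ← mul_assoc (ev d l) (ev d k), ev_anticomm hlk']
        simp only [neg_mul, neg_neg, mul_assoc]
      rw [hsM j l hjl hlk, ← mul_assoc _ _ (ev d k), h, add_zero]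
    · obtain rfl : l = k := Fin.ext hlk
      -- The vector `e_l` commutes with `s` but anticommutes with `e_j`, so cyclicity equates this
      -- trace with its negative.
      have h1 : tr d (ev d l * ev d j * s) = 0 := by
        have h2 : tr d (ev d l * ev d j * s) = tr d (ev d j * ev d l * s) := by
          rw [mul_assoc, tr_mul_comm, mul_assoc, (hs.commute_ev l le_rfl).eq, ← mul_assoc]
        have h3 := tr_ev_ev_swap hjl.ne s
        linarith
      have h4 : tr d (ev d l * ev d j * (s * i d w' * ev d l)) =
          -∑ m, w m * tr d (ev d m * ev d j * s) := by
        rw [← mul_assoc, tr_mul_comm, ← mul_assoc, ← mul_assoc, ← mul_assoc (ev d l) (ev d l),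
          ev_sq, neg_one_mul, neg_mul, neg_mul, map_neg, tr_mul_comm, i_apply, Finset.sum_mul, map_sum]
        congr 1
        refine Finset.sum_congr rfl fun m _ => ?_
        rw [smul_mul_assoc, map_smul, ← mul_assoc, smul_eq_mul]
      have h5 := hw j
      simp only [hjl, if_true, true_and] at h5
      rw [h1, zero_add, h4, ← h5, ← Finset.add_sum_erase _ _ (Finset.mem_univ j), tr_ev_ev_self,
        hs.tr_eq_one, neg_add, mul_neg, mul_one, neg_neg, sub_eq_add_neg,
        ← Finset.add_sum_erase _ (fun m => _ * w m) (Finset.mem_univ j)]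
      simp only [ne_eq, not_true_eq_false, and_false, if_false, zero_mul, zero_add]
      congr 2
      refine Finset.sum_congr rfl fun m hm => ?_
      have hm' : j ≠ m := (Finset.ne_of_mem_erase hm).symm
      by_cases hml : m < l
      · rw [if_pos ⟨hml, hm'⟩, mul_comm]
      · rw [if_neg fun h => hml h.1, hw0 m (not_lt.1 hml), zero_mul, zero_mul]

/-! ### Translations and the elements of `T_{ap}` -/

/-- The element of `X_d` that represents the point `v` of `ℝ^d`. -/
noncomputable def point {d : ℕ} (v : EuclideanSpace ℝ (Fin d)) : X d := eLast d * i d v + ePen d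

/-- The element of `Spun(d)` that acts as the translation by `2w`. -/
noncomputable def translator {d : ℕ} (w : EuclideanSpace ℝ (Fin d)) : X d :=
  1 + eLast d * (ePen d * i d w)

theorem mul_eLast_mul {d : ℕ} (x y : X d) : x * (eLast d * y) = eLast d * (x * y) := by
  rw [← mul_assoc, ← eLast_mul_comm, mul_assoc]

theorem eLast_mul_eLast_mul {d : ℕ} (x : X d) : eLast d * (eLast d * x) = 0 := by
  rw [← mul_assoc, eLast_sq, zero_mul]

theorem conj_translator {d : ℕ} (w : EuclideanSpace ℝ (Fin d)) :
    conj (translator w) = 1 - eLast d * (ePen d * i d w) := by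
  rw [translator, conj_add, conj_one, conj_mul, conj_mul, conj_i, conj_ePen, conj_eLast,
    ← eLast_mul_comm, neg_mul_neg, i_mul_ePen, mul_neg, ← sub_eq_add_neg]

theorem translator_mul_conj {d : ℕ} (w : EuclideanSpace ℝ (Fin d)) :
    translator w * conj (translator w) = 1 := by
  rw [conj_translator, translator, mul_sub, mul_one, mul_eLast_mul, add_mul, one_mul, mul_add,
    mul_assoc, eLast_mul_eLast_mul, add_zero, add_sub_cancel_right]

/-- Each of the two factors contributes one `eLast d * i d w`, and the second-order terms die with
`e_{d+2}^2 = 0`. -/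
theorem translator_sandwich {d : ℕ} (w v : EuclideanSpace ℝ (Fin d)) :
    translator w * point v * conj (translator w) = point (v + (2 : ℝ) • w) := by
  have h1 : ePen d * i d w * ePen d = i d w := by
    rw [mul_assoc, i_mul_ePen, mul_neg, ← mul_assoc, ePen_sq, neg_one_mul, neg_neg]
  have h2 : ePen d * (ePen d * i d w) = -i d w := by
    rw [← mul_assoc, ePen_sq, neg_one_mul]
  have h3 : translator w * point v = point v + eLast d * i d w := by
    rw [translator, add_mul, one_mul, point, mul_add (eLast d * _), mul_eLast_mul, mul_assoc,
      eLast_mul_eLast_mul, zero_add, mul_assoc, h1]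
  rw [h3, conj_translator, mul_sub, mul_one, mul_eLast_mul, point, point, add_mul, add_mul, h2,
    mul_add, mul_add, mul_assoc, mul_assoc, eLast_mul_eLast_mul, eLast_mul_eLast_mul, map_add,
    map_smul, mul_add, mul_smul_comm, mul_neg]
  module

theorem translator_mem_stab {d : ℕ} (w : EuclideanSpace ℝ (Fin d)) : translator w ∈ stab d := by
  have h : translator w = 1 - i d w * f d (Fin.last d) := by
    rw [translator, f_last, ← mul_assoc (i d w), i_mul_ePen, neg_mul, sub_neg_eq_add,
      ← eLast_mul_comm]
  rw [h]
  exact sub_mem (one_mem _) (i_mul_f_mem_stab _ _)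

theorem tr_translator_mul {d : ℕ} (w : EuclideanSpace ℝ (Fin d)) (x : X d) :
    tr d (translator w * x) = tr d x := by
  rw [translator, add_mul, one_mul, mul_assoc, map_add, tr_eLast_mul, add_zero]

theorem tr_mul_translator {d : ℕ} (w : EuclideanSpace ℝ (Fin d)) (x : X d) :
    tr d (x * translator w) = tr d x := by
  rw [tr_mul_comm, tr_translator_mul]

theorem mul_sandwich {d : ℕ} {x y u v w : X d} (hy : y * u * conj y = v) (hx : x * v * conj x = w) :
    x * y * u * conj (x * y) = w := by
  rw [← hx, ← hy, conj_mul]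
  simp only [mul_assoc]

theorem mul_mul_conj_mul {d : ℕ} {x y : X d} (hx : x * conj x = 1) (hy : y * conj y = 1) :
    x * y * conj (x * y) = 1 := by
  rw [conj_mul, mul_assoc, ← mul_assoc y, hy, one_mul, hx]

theorem exists_mem_T {d : ℕ} (a p : EuclideanSpace ℝ (Fin d)) (M : Fin d → Fin d → ℝ) :
    ∃ x ∈ T a p, tr d x ≠ 0 ∧
      ∀ j l : Fin d, j < l → tr d (ev d l * ev d j * x) = tr d x * M j l := by
  obtain ⟨s, hs, hsM⟩ := exists_isRotor M d le_rfl
  obtain ⟨c, hc, hN⟩ := hs.mul_conj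
  obtain ⟨r, hr0, hr⟩ : ∃ r : ℝ, r ≠ 0 ∧ r * (r * c) = 1 := by
    have h := (Real.sqrt_pos.2 hc).ne'
    refine ⟨(√c)⁻¹, inv_ne_zero h, ?_⟩
    rw [← mul_assoc, ← mul_inv, Real.mul_self_sqrt hc.le, inv_mul_cancel₀ hc.ne']
  have hsN : (r • s) * conj (r • s) = 1 := by
    rw [conj_smul, smul_mul_smul_comm, hN, smul_smul, mul_assoc, hr, one_smul]
  have hsv : ∀ v, ∃ w, (r • s) * point v * conj (r • s) = point w ∧
      i d w = r • r • (s * i d v * conj s) := by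
    intro v
    obtain ⟨w, hw⟩ := hs.sandwich v
    refine ⟨r • r • w, ?_, by rw [hw, map_smul, map_smul]⟩
    rw [point, mul_add, mul_eLast_mul, (hs.commute_ePen.smul_left r).eq, add_mul, mul_assoc (ePen d),
      hsN, mul_one, point, map_smul, map_smul, ← hw, conj_smul, mul_assoc]
    simp only [smul_mul_assoc, mul_smul_comm]
  have hs0 : (r • s) * point 0 * conj (r • s) = point (0 : EuclideanSpace ℝ (Fin d)) := by
    obtain ⟨w, hw, hw'⟩ := hsv 0
    rw [hw, point, point, hw']
    simp
  -- The point `a` goes to `0`, is fixed there by the rotor, then goes to `p`; the halves compensate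
  -- for `translator w` moving by `2w`. Translators are `1` modulo `e_{d+2}`, so no `tr d (y * x)`
  -- sees them.
  set x : X d := translator ((2⁻¹ : ℝ) • p) * ((r • s) * translator (-(2⁻¹ : ℝ) • a)) with hx
  have hxZ : x ∈ Z d := stab_le_Z
    (mul_mem (translator_mem_stab _) (mul_mem ((stab d).smul_mem hs.mem_stab _)
      (translator_mem_stab _)))
  have hxN : x * conj x = 1 :=
    mul_mul_conj_mul (translator_mul_conj _) (mul_mul_conj_mul hsN (translator_mul_conj _))
  have htr : ∀ y, tr d (y * x) = r * tr d (y * s) := by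
    intro y
    rw [hx, ← mul_assoc (translator _), ← mul_assoc y, tr_mul_translator, tr_mul_comm, mul_assoc,
      tr_translator_mul, tr_mul_comm, mul_smul_comm, map_smul, smul_eq_mul]
  have htr1 : tr d x = r := by
    have := htr 1
    rwa [one_mul, one_mul, hs.tr_eq_one, mul_one] at this
  refine ⟨⟨x, hxZ⟩, ⟨⟨hxN, fun v => ?_⟩, ?_⟩, ?_, fun j l hjl => ?_⟩
  · obtain ⟨w, hw, -⟩ := hsv (v + (2 : ℝ) • (-(2⁻¹ : ℝ) • a))
    exact ⟨_, mul_sandwich (mul_sandwich (translator_sandwich _ v) hw) (translator_sandwich _ w)⟩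
  · refine (mul_sandwich (mul_sandwich (translator_sandwich _ a) ?_)
      (translator_sandwich _ 0)).trans ?_
    · rw [smul_smul, mul_neg, mul_inv_cancel₀ two_ne_zero, neg_one_smul, add_neg_cancel, hs0]
    · rw [smul_smul, mul_inv_cancel₀ two_ne_zero, one_smul, zero_add]; rfl
  · change tr d x ≠ 0
    rwa [htr1]
  · change tr d (_ * x) = tr d x * _
    rw [htr, htr1, hsM j l hjl l.2]

theorem trDual_eq_of_mem_T {d : ℕ} {a p : EuclideanSpace ℝ (Fin d)} {x : Z d} (hx : x ∈ T a p)
    (k : Fin d) : 2 * trDual d (ePen d * ev d k * x)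
      + ∑ l, (a l * tr d (ev d l * ev d k * x) - p l * tr d (ev d k * ev d l * x)) = 0 := by
  -- A right inverse is also a left inverse among endomorphisms of a finite-dimensional space.
  -- Working in the representation is enough because `trDual` factors through it.
  have h1 : action d x * action d (conj (x : X d)) = 1 := by
    rw [← map_mul, ← map_one (action d)]; exact congrArg _ hx.1.1
  have h2 : action d (x * point a) = action d (point p * x) := by
    have h := congrArg (action d) hx.2
    rw [map_mul] at h
    change _ = action d (point p) at h
    rw [map_mul (action d) (point p), ← h, mul_assoc,
      mul_eq_one_comm.1 h1, mul_one]
    rfl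
  have h3 : trDual d (ev d k * (x * point a)) = trDual d (ev d k * (point p * x)) := by
    simp only [trDual, coord_apply, map_mul (action d) (ev d k), h2]
  have h4 : trDual d (ev d k * (x * point a)) =
      ∑ l, a l * tr d (ev d l * ev d k * x) + trDual d (ePen d * ev d k * x) := by
    rw [← mul_assoc, trDual_mul_comm, point, add_mul, map_add, mul_assoc, trDual_eLast_mul,
      ← mul_assoc (ePen d), i_apply, Finset.sum_mul, map_sum]
    simp only [smul_mul_assoc, map_smul, smul_eq_mul, mul_assoc]
  have h5 : trDual d (ev d k * (point p * x)) =
      ∑ l, p l * tr d (ev d k * ev d l * x) - trDual d (ePen d * ev d k * x) := by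
    rw [point, add_mul, mul_add, map_add, ← mul_assoc (ev d k) (ePen d), ev_mul_ePen, neg_mul,
      map_neg, mul_assoc (eLast d), mul_eLast_mul, trDual_eLast_mul, i_apply, Finset.sum_mul,
      Finset.mul_sum, map_sum, sub_eq_add_neg]
    simp only [smul_mul_assoc, mul_smul_comm, map_smul, smul_eq_mul, mul_assoc]
  rw [Finset.sum_sub_distrib]
  linarith

/-! ### Skew coordinates on the space of pairs -/

/-- The coefficient of the product of two basis vectors, as a skew-symmetric function. -/
noncomputable def bivec {d : ℕ} (j k : Fin d) : PairSpace d →ₗ[ℝ] ℝ :=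
  if h : j < k then
    LinearMap.proj ⟨{j.castSucc, k.castSucc}, Finset.card_pair (by simpa using h.ne)⟩
  else if h : k < j then
    -LinearMap.proj ⟨{k.castSucc, j.castSucc}, Finset.card_pair (by simpa using h.ne)⟩
  else 0

/-- The coefficient of the product of a basis vector with the null vector. -/
noncomputable def boost {d : ℕ} (k : Fin d) : PairSpace d →ₗ[ℝ] ℝ :=
  LinearMap.proj ⟨{k.castSucc, Fin.last d}, Finset.card_pair (Fin.castSucc_lt_last k).ne⟩

theorem bivec_of_lt {d : ℕ} {j k : Fin d} (h : j < k) (y : PairSpace d) :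
    bivec j k y = y ⟨{j.castSucc, k.castSucc}, Finset.card_pair (by simpa using h.ne)⟩ := by
  rw [bivec, dif_pos h]; rfl

theorem bivec_swap {d : ℕ} (j k : Fin d) (y : PairSpace d) : bivec j k y = -bivec k j y := by
  rcases lt_trichotomy j k with h | rfl | h
  · simp [bivec, h, h.not_gt]
  · simp [bivec]
  · simp [bivec, h, h.not_gt]

theorem bivec_self {d : ℕ} (j : Fin d) (y : PairSpace d) : bivec j j y = 0 := by simp [bivec]

theorem exists_pair_eq {d : ℕ} {S : Finset (Fin (d + 1))} (hS : S.card = 2) :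
    (∃ j k : Fin d, j < k ∧ S = {j.castSucc, k.castSucc}) ∨
      ∃ k : Fin d, S = {k.castSucc, Fin.last d} := by
  obtain ⟨m, n, hmn, rfl⟩ : ∃ m n, m < n ∧ S = {m, n} := by
    obtain ⟨m, n, hmn, rfl⟩ := Finset.card_eq_two.1 hS
    rcases hmn.lt_or_gt with h | h
    · exact ⟨m, n, h, rfl⟩
    · exact ⟨n, m, h, Finset.pair_comm m n⟩
  induction m using Fin.lastCases with
  | last => exact absurd hmn (Fin.le_last n).not_gt
  | cast j =>
    induction n using Fin.lastCases with
    | last => exact Or.inr ⟨j, rfl⟩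
    | cast k => exact Or.inl ⟨j, k, Fin.castSucc_lt_castSucc_iff.1 hmn, rfl⟩

theorem pairSpace_ext {d : ℕ} {y y' : PairSpace d}
    (h1 : ∀ j k : Fin d, j < k → bivec j k y = bivec j k y') (h2 : ∀ k, boost k y = boost k y') :
    y = y' := by
  funext ⟨S, hS⟩
  obtain ⟨j, k, hjk, rfl⟩ | ⟨k, rfl⟩ := exists_pair_eq hS
  · have h := h1 j k hjk
    rwa [bivec_of_lt hjk, bivec_of_lt hjk] at h
  · exact h2 k

theorem exists_bivec_boost {d : ℕ} (M : Fin d → Fin d → ℝ) (hM : ∀ j k, M j k = -M k j)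
    (c : Fin d → ℝ) :
    ∃ y : PairSpace d, (∀ j k, bivec j k y = M j k) ∧ ∀ k, boost k y = c k := by
  -- Both values `0` occur only when the smaller index `m` is the last one, which no pair `m < n`
  -- allows.
  let M' : Fin (d + 1) → Fin (d + 1) → ℝ :=
    fun m => Fin.lastCases (Fin.lastCases 0 c m) fun k => Fin.lastCases 0 (fun j => M j k) m
  let y : PairSpace d := fun S =>
    M' (S.1.min' (Finset.card_pos.1 (by rw [S.2]; exact two_pos)))
      (S.1.max' (Finset.card_pos.1 (by rw [S.2]; exact two_pos)))
  have hy : ∀ (m n : Fin (d + 1)) (h : m < n), y ⟨{m, n}, Finset.card_pair h.ne⟩ = M' m n := by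
    intro m n h
    simp [y, h.le]
  have hlt : ∀ j k, j < k → bivec j k y = M j k := by
    intro j k h
    rw [bivec_of_lt h, hy _ _ (Fin.castSucc_lt_castSucc_iff.2 h)]
    simp [M']
  refine ⟨y, fun j k => ?_, fun k => ?_⟩
  · rcases lt_trichotomy j k with h | rfl | h
    · exact hlt j k h
    · have := hM j j
      rw [bivec_self]; linarith
    · rw [bivec_swap, hlt k j h, hM j k]
  · rw [boost, LinearMap.proj_apply, hy _ _ (Fin.castSucc_lt_last k)]
    simp [M']

theorem bivec_eta {d : ℕ} {j k : Fin d} (h : j ≠ k) (x : Z d) :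
    bivec j k (eta x) = (tr d x)⁻¹ * tr d (ev d k * ev d j * x) := by
  have hlt : ∀ {j k : Fin d}, j < k →
      bivec j k (eta x) = (tr d x)⁻¹ * tr d (ev d k * ev d j * x) := by
    intro j k h
    rw [bivec_of_lt h, eta, map_smul, Finsupp.smul_apply, repr_zBasis, firstCoord_eq, tr_ev_ev h,
      smul_eq_mul]
  rcases h.lt_or_gt with h' | h'
  · exact hlt h'
  · rw [bivec_swap, hlt h', tr_ev_ev_swap h, mul_neg]

theorem boost_eta {d : ℕ} (k : Fin d) (x : Z d) :
    boost k (eta x) = (tr d x)⁻¹ * trDual d (ePen d * ev d k * x) := by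
  rw [boost, LinearMap.proj_apply, eta, map_smul, Finsupp.smul_apply, repr_zBasis, firstCoord_eq,
    trDual_ePen_ev, smul_eq_mul]

/-! ### The linear equations of `L_{ap}` -/

/-- Contraction of the bivector part with a vector. -/
noncomputable def contract {d : ℕ} (m : EuclideanSpace ℝ (Fin d)) :
    PairSpace d →ₗ[ℝ] (Fin d → ℝ) :=
  LinearMap.pi fun k => ∑ l, m l • bivec k l

theorem contract_apply {d : ℕ} (m : EuclideanSpace ℝ (Fin d)) (y : PairSpace d) (k : Fin d) :
    contract m y k = ∑ l, m l * bivec k l y := by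
  simp [contract]

/-- The linear part of the equations of `L_{ap}`, where `m = a + p`. -/
noncomputable def flatMap {d : ℕ} (m : EuclideanSpace ℝ (Fin d)) :
    PairSpace d →ₗ[ℝ] (Fin d → ℝ) :=
  (2 : ℝ) • LinearMap.pi boost + contract m

theorem flatMap_apply {d : ℕ} (m : EuclideanSpace ℝ (Fin d)) (y : PairSpace d) (k : Fin d) :
    flatMap m y k = 2 * boost k y + contract m y k := by
  simp [flatMap]

theorem flatMap_eta {d : ℕ} {a p : EuclideanSpace ℝ (Fin d)} {x : Z d} (hx : x ∈ T a p)
    (hx0 : tr d x ≠ 0) : flatMap (a + p) (eta x) = ⇑(a - p) := by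
  funext k
  have h := trDual_eq_of_mem_T hx k
  -- The term `l = k`, where `e_k e_k = -1`, produces the inhomogeneous part `a - p`; the other
  -- terms add up to a contraction with `a + p`.
  have hl : ∀ l, a l * tr d (ev d l * ev d k * x) - p l * tr d (ev d k * ev d l * x) =
      tr d x * ((a + p) l * bivec k l (eta x)) - if l = k then tr d x * (a - p) k else 0 := by
    intro l
    by_cases hlk : l = k
    · subst hlk
      rw [bivec_self, tr_ev_ev_self, if_pos rfl]
      simp only [PiLp.sub_apply]; ring
    · rw [bivec_eta (Ne.symm hlk), if_neg hlk, tr_ev_ev_swap hlk, mul_comm ((a + p) l),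
        ← mul_assoc (tr d x), ← mul_assoc (tr d x), mul_inv_cancel₀ hx0]
      simp only [PiLp.add_apply]; ring
  rw [Finset.sum_congr rfl fun l _ => hl l, Finset.sum_sub_distrib, Finset.sum_ite_eq',
    if_pos (Finset.mem_univ k), ← Finset.mul_sum] at h
  rw [flatMap_apply, contract_apply, boost_eta]
  refine mul_left_cancel₀ hx0 ?_
  rw [mul_add, mul_left_comm, ← mul_assoc (tr d x), mul_inv_cancel₀ hx0]
  linarith

theorem L_eq {d : ℕ} (a p : EuclideanSpace ℝ (Fin d)) :
    L a p = {y | flatMap (a + p) y = ⇑(a - p)} := by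
  ext y
  constructor
  · rintro ⟨x, ⟨hx, hx0⟩, rfl⟩
    refine flatMap_eta hx ?_
    rw [← firstCoord_eq]
    exact hx0
  · intro hy
    obtain ⟨x, hx, hx0, hM⟩ := exists_mem_T a p fun j l => bivec j l y
    have hb : ∀ j k, j < k → bivec j k (eta x) = bivec j k y := by
      intro j k h
      rw [bivec_eta h.ne, hM j k h, inv_mul_cancel_left₀ hx0]
    have hb' : ∀ j k, bivec j k (eta x) = bivec j k y := by
      intro j k
      rcases lt_trichotomy j k with h | rfl | h
      · exact hb j k h
      · rw [bivec_self, bivec_self]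
      · rw [bivec_swap, hb k j h, ← bivec_swap]
    refine ⟨x, ⟨hx, fun h => hx0 (by rw [← firstCoord_eq]; exact h)⟩, pairSpace_ext hb fun k => ?_⟩
    have h := congrFun ((flatMap_eta hx hx0).trans hy.symm) k
    simp only [flatMap_apply, contract_apply, hb'] at h
    linarith

/-! ### Dimensions -/

theorem isFlat_fiber {V W : Type*} [AddCommGroup V] [Module ℝ V] [AddCommGroup W] [Module ℝ W]
    (φ : V →ₗ[ℝ] W) {c : W} (hc : ∃ y, φ y = c) :
    IsFlat (Module.finrank ℝ (LinearMap.ker φ)) {y | φ y = c} := by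
  obtain ⟨y, hy⟩ := hc
  refine ⟨AffineSubspace.mk' y (LinearMap.ker φ), ?_, ⟨y, hy⟩, by
    rw [AffineSubspace.direction_mk']⟩
  ext z
  rw [SetLike.mem_coe, AffineSubspace.mem_mk', LinearMap.mem_ker, vsub_eq_sub, map_sub, hy,
    sub_eq_zero]
  rfl

/-- The boost coordinates alone already reach every value. -/
theorem flatMap_surjective {d : ℕ} (m : EuclideanSpace ℝ (Fin d)) :
    Function.Surjective (flatMap m) := by
  intro c
  obtain ⟨y, h1, h2⟩ := exists_bivec_boost (d := d) 0 (by simp) fun k => 2⁻¹ * c k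
  refine ⟨y, funext fun k => ?_⟩
  simp [flatMap_apply, contract_apply, h1, h2]

theorem finrank_ker_flatMap {d : ℕ} (m : EuclideanSpace ℝ (Fin d)) :
    Module.finrank ℝ (LinearMap.ker (flatMap m)) = d.choose 2 := by
  have h := LinearMap.finrank_range_add_finrank_ker (flatMap m)
  rw [LinearMap.range_eq_top.2 (flatMap_surjective m), finrank_top, finrank_pairSpace,
    Module.finrank_fin_fun, Nat.choose_succ_succ' d 1, Nat.choose_one_right] at h
  exact Nat.add_left_cancel h

theorem isFlat_L {d : ℕ} (a p : EuclideanSpace ℝ (Fin d)) : IsFlat (d.choose 2) (L a p) := by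
  rw [L_eq, ← finrank_ker_flatMap (a + p)]
  exact isFlat_fiber _ (flatMap_surjective _ _)

theorem sum_mul_contract {d : ℕ} (m : EuclideanSpace ℝ (Fin d)) (y : PairSpace d) :
    ∑ k, m k * contract m y k = 0 := by
  have h : ∑ k, m k * contract m y k = -∑ k, m k * contract m y k := by
    simp only [contract_apply, Finset.mul_sum]
    conv_lhs => rw [Finset.sum_comm]
    rw [← Finset.sum_neg_distrib]
    refine Finset.sum_congr rfl fun k _ => ?_
    rw [← Finset.sum_neg_distrib]
    refine Finset.sum_congr rfl fun l _ => ?_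
    rw [bivec_swap l k]; ring
  linarith

theorem exists_flatMap_contract {d : ℕ} (m m' : EuclideanSpace ℝ (Fin d)) (hm : m ≠ 0)
    (u n : Fin d → ℝ) (hn : ∑ k, m k * n k = 0) :
    ∃ y, flatMap m' y = u ∧ contract m y = n := by
  have hpos : ∑ k, m k * m k ≠ 0 := by
    intro h
    refine hm (PiLp.ext fun k => ?_)
    exact mul_self_eq_zero.1
      ((Finset.sum_eq_zero_iff_of_nonneg fun j _ => mul_self_nonneg _).1 h k (Finset.mem_univ k))
  set Q := ∑ k, m k * m k with hQ
  -- The bivector `n ∧ m / |m|²` contracts with `m` to `n` because `m` and `n` are orthogonal; the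
  -- boosts are then chosen to meet the value `u`.
  let M : Fin d → Fin d → ℝ := fun j k => (n j * m k - m j * n k) / Q
  obtain ⟨y, h1, h2⟩ := exists_bivec_boost M (fun j k => by simp only [M]; ring)
    fun k => 2⁻¹ * (u k - ∑ l, m' l * M k l)
  refine ⟨y, funext fun k => ?_, funext fun k => ?_⟩
  · rw [flatMap_apply, contract_apply, h2]
    simp only [h1]
    ring
  · rw [contract_apply]
    have h3 : ∀ l, m l * bivec k l y = (n k / Q) * (m l * m l) - (m k / Q) * (m l * n l) := by
      intro l
      rw [h1]
      simp only [M]; ring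
    simp only [h3]
    rw [Finset.sum_sub_distrib, ← Finset.mul_sum, ← Finset.mul_sum, hn, ← hQ, mul_zero, sub_zero,
      div_mul_cancel₀ _ hpos]

/-- The pairing of the second component with `m`. -/
noncomputable def pairing {d : ℕ} (m : EuclideanSpace ℝ (Fin d)) :
    ((Fin d → ℝ) × (Fin d → ℝ)) →ₗ[ℝ] ℝ :=
  (∑ k, m k • LinearMap.proj k) ∘ₗ LinearMap.snd ℝ (Fin d → ℝ) (Fin d → ℝ)

theorem pairing_apply {d : ℕ} (m : EuclideanSpace ℝ (Fin d)) (u n : Fin d → ℝ) :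
    pairing m (u, n) = ∑ k, m k * n k := by
  simp [pairing]

theorem finrank_ker_flatMap_prod_contract {d : ℕ} (m m' : EuclideanSpace ℝ (Fin d)) (hm : m ≠ 0) :
    Module.finrank ℝ (LinearMap.ker ((flatMap m').prod (contract m))) = (d - 1).choose 2 := by
  have hrange : LinearMap.range ((flatMap m').prod (contract m)) = LinearMap.ker (pairing m) := by
    ext ⟨u, n⟩
    rw [LinearMap.mem_ker, pairing_apply]
    constructor
    · rintro ⟨y, hy⟩
      obtain rfl : contract m y = n := congrArg Prod.snd hy
      exact sum_mul_contract m y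
    · intro hn
      obtain ⟨y, h1, h2⟩ := exists_flatMap_contract m m' hm u n hn
      exact ⟨y, Prod.ext h1 h2⟩
  have hsurj : LinearMap.range (pairing m) = ⊤ := by
    refine LinearMap.range_eq_top.2 (LinearMap.surjective fun h => hm (PiLp.ext fun k => ?_))
    have h1 := LinearMap.congr_fun h (0, Pi.single k 1)
    rw [pairing_apply, Finset.sum_eq_single k (fun l _ hl => by rw [Pi.single_eq_of_ne hl, mul_zero])
      (by simp), Pi.single_eq_same, mul_one] at h1
    exact h1
  have h1 := LinearMap.finrank_range_add_finrank_ker ((flatMap m').prod (contract m))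
  have h2 := LinearMap.finrank_range_add_finrank_ker (pairing m)
  rw [hsurj, finrank_top, Module.finrank_self, Module.finrank_prod, Module.finrank_fin_fun] at h2
  rw [hrange, finrank_pairSpace] at h1
  -- In dimension zero no `m ≠ 0` exists, so the truncated `d - 1` is harmless.
  cases d with
  | zero => exact absurd (PiLp.ext fun k => k.elim0) hm
  | succ n =>
    have h3 : (n + 1 + 1).choose 2 = (n + 1) + (n + n.choose 2) := by
      rw [Nat.choose_succ_succ' (n + 1) 1, Nat.choose_succ_succ' n 1, Nat.choose_one_right,
        Nat.choose_one_right]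
    rw [Nat.add_sub_cancel]
    omega

theorem contract_eq_of_flatMap {d : ℕ} (m m' : EuclideanSpace ℝ (Fin d)) (y : PairSpace d) :
    flatMap m y - flatMap m' y = contract (m - m') y := by
  funext k
  simp only [Pi.sub_apply, flatMap_apply, contract_apply, PiLp.sub_apply, sub_mul,
    Finset.sum_sub_distrib]
  ring

end SpunGroup

open SpunGroup in
theorem lemma5p13 (d : ℕ) (a p b q : EuclideanSpace ℝ (Fin d))
    (hT : T a p ≠ T b q) (hH : ¬ (T a p ∩ T b q ⊆ H0 d)) :
    IsFlat (d.choose 2) (L a p) ∧ IsFlat (d.choose 2) (L b q) ∧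
      IsFlat ((d - 1).choose 2) (L a p ∩ L b q) := by
  refine ⟨isFlat_L a p, isFlat_L b q, ?_⟩
  obtain ⟨x, ⟨hx1, hx2⟩, hx0⟩ := Set.not_subset.1 hH
  have hy1 : eta x ∈ L a p := ⟨x, ⟨hx1, hx0⟩, rfl⟩
  have hy2 : eta x ∈ L b q := ⟨x, ⟨hx2, hx0⟩, rfl⟩
  rw [L_eq] at hy1 hy2
  have hinter : L a p ∩ L b q = {y | ((flatMap (a + p)).prod (contract (a + p - (b + q)))) y =
      (⇑(a - p), ⇑(a - p) - ⇑(b - q))} := by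
    ext y
    rw [L_eq, L_eq]
    change flatMap (a + p) y = _ ∧ flatMap (b + q) y = _ ↔ (_, _) = (_, _)
    rw [Prod.mk.injEq, ← contract_eq_of_flatMap]
    refine and_congr_right fun h => ?_
    rw [h, sub_right_inj]
  -- If `a + p = b + q`, the equations at the common point `eta x` have equal left sides, so `a - p
  -- = b - q`. Then `a = b` and `p = q`, against `T a p ≠ T b q`.
  have hm : a + p - (b + q) ≠ 0 := by
    intro h
    have h1 := contract_eq_of_flatMap (a + p) (b + q) (eta x)
    have h2 : a - p = b - q := by
      refine PiLp.ext fun k => ?_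
      have := congrFun h1 k
      rw [hy1, hy2, h, contract_apply] at this
      simpa [sub_eq_zero] using this
    have h3 : a = b := by
      have h4 : (2 : ℝ) • a = (2 : ℝ) • b := by
        have h5 := congrArg₂ (· + ·) (sub_eq_zero.1 h) h2
        simp only [add_add_sub_cancel] at h5
        rwa [two_smul, two_smul]
      exact smul_right_injective _ (two_ne_zero (α := ℝ)) h4
    subst h3
    exact hT (by rw [sub_right_inj.1 h2])
  rw [hinter, ← finrank_ker_flatMap_prod_contract _ (a + p) hm]
  refine isFlat_fiber _ ⟨eta x, ?_⟩
  have : eta x ∈ L a p ∩ L b q := ⟨⟨x, ⟨hx1, hx0⟩, rfl⟩, ⟨x, ⟨hx2, hx0⟩, rfl⟩⟩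
  rw [hinter] at this
  exact this
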